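/- Logarithms are to base 2, $\|\cdot\|$ is statistical distance ($\max_E|P(E)-Q(E)|$ over events $E$), $\mathrm{HD}$ is Hamming distance, a $\kappa$-source is a random variable with min-entropy $\min_x(-\log P(x))\ge\kappa$, and $x^S$ is the restriction of $x$ to the positions in $S$. A function of $\ell$ is negligible if it decays faster than every inverse polynomial. **Tools.** A pair $\mathrm{Ext}:\{0,1\}^\ell\times\{0,1\}^r\to\{0,1\}^q\times\{0,1\}^p$, $\mathrm{Rec}:\{0,1\}^\ell\times\{0,1\}^r\times\{0,1\}^p\to\{0,1\}^q$ is a $(\kappa,\varepsilon,\delta,\beta)$-fuzzy extractor if (i) for every $\kappa$-source $X$, uniform $R$ and $(Y,P)=\mathrm{Ext}(X,R)$ we have $\|P_{YRP}-U_q\times P_{RP}\|\le\varepsilon$, and (ii) whenever $\mathrm{HD}(x,x')\le\delta\ell$, $\Pr_R[\mathrm{Rec}(x',R,P)=Y]\ge1-\beta$, where $(Y,P)=\mathrm{Ext}(x,R)$. Interactive hashing is a two-party protocol in which Bob inputs $W\in\{0,1\}^m$ and both parties output $W_0<W_1$ in $\{0,1\}^m$ (lexicographic order) with $W\in\{W_0,W_1\}$;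 it is $\eta$-uniform $(t,\theta)$-secure if, for uniform $W$ and honest Bob, the view of any (possibly malicious) Alice has the same law given $W=W_0$ as given $W=W_1$; for honest parties the output other than $W$ is $\eta$-close to uniform on $\{0,1\}^m\setminus\{W\}$; and for honest Alice, any Bob and any $T\subseteq\{0,1\}^m$ with $|T|\le2^t$, $\Pr[W_0,W_1\in T]\le\theta$. A dense encoding is an injective map $F:\binom{[k]}{\ell}\times[\lfloor2^m/\binom k\ell\rfloor]\to\{0,1\}^m$; $F(C,j)$ encodes the set $C$, and strings outside the image are invalid. **Parameters.** Fix $\tau>0$, $0<\zeta<1$, $c>0$, positive negligible functions $\varepsilon',\hat\varepsilon$ and negligible functions $\varepsilon_F,\theta$ of the security parameter $\ell\ge1$. An instance for $\ell$ is given by $n\ge1$, $k=\lceil2\sqrt{\ell n}\rceil\le n$, reals $0<\alpha<1$, $\gamma<\alpha$, $\delta\ge0$, $\xi>0$, $0<m_F<1$, $R$, $t$, and integers $m,r$, $q=m_F\ell$, $p=(1-R)\ell$ such that, with $$\rho=\alpha-\gamma-\frac{1+\log(1/\varepsilon')}{n},\quad \nu=\frac{\tau}{\log(1/\tau)},\quad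 \varepsilon''=e^{-\ell\nu^2/2}+2^{-c\tau n},$$ $$k_F=\rho+R-3\tau-2m_F-1-\frac{1+\log(1/\hat\varepsilon)}{\ell},$$ we have $3\tau\le\rho$, $m\ge2\ell\log k$ and $t\ge m-\zeta\log\frac1{\varepsilon'+\varepsilon''}$, together with a $(k_F\ell,\varepsilon_F,\delta+\xi,0)$-fuzzy extractor $(\mathrm{Ext},\mathrm{Rec})$ with the above $\ell,r,q,p$, a $2^{-m}$-uniform $(t,\theta)$-secure interactive hashing protocol for $m$-bit strings, and a dense encoding of the $\ell$-subsets of a $k$-set. **Protocol with honest Alice and malicious Bob.** Alice has an $\alpha n$-source $X\in\{0,1\}^n$ and Bob has $\tilde X\in\{0,1\}^n$ with $\mathrm{HD}(X,\tilde X)\le\delta n$ always. Bob has a choice bit $c_B$ and local randomness independent of $(X,\tilde X)$; from these and $\tilde X$ he computes a string of at most $\gamma n$ bits, which is all he keeps of $\tilde X$; afterwards he is unbounded. Alice picks a uniform $k$-subset $A$ of $[n]$. *Setup:* Alice sends $A$; the parties run interactive hashing, in which Bob may deviate arbitrarily, giving $W_0,W_1$, which encode $C_0,C_1\subset A$; if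 one is invalid, Alice aborts. *Transfer:* Bob sends a bit $e$ of his choice, or aborts. Alice, with secrets $s_0,s_1\in\{0,1\}^q$, picks independent uniform $R_0,R_1\in\{0,1\}^r$, computes $(Y_j,P_j)=\mathrm{Ext}(X^{C_j},R_j)$ and sends $(s_{j\oplus e}\oplus Y_j,R_j,P_j)$ for $j=0,1$. Bob's view at the end of setup consists of his local randomness, his stored string, $A$, the messages of interactive hashing and $W_0,W_1$; his view of the protocol also contains Alice's transfer messages (or the fact of an abort). **Lemma (security for Alice).** There is a negligible function $\lambda_A$, depending only on $\tau,\zeta,c,\varepsilon',\hat\varepsilon,\varepsilon_F,\theta$, such that for every $\ell\ge1$ and every instance for $\ell$ the protocol is $\lambda_A(\ell)$-secure for Alice: for every joint law of $(X,\tilde X)$ as above, every such strategy of Bob and every choice bit, there is an index $i\in\{0,1\}$, a function of Bob's view at the end of setup, such that for any two $i$-consistent pairs of secrets $(s_0,s_1),(s_0',s_1')$ (that is, $s_i=s_i'$; since the secrets are only used after setup, the pairs may depend on Bob's view at the end of setup), the laws of Bob's view of the protocol with secrets $(s_0,s_1)$ and with secrets $(s_0',s_1')$ have statistical distance at most $\lambda_A(\ell)$.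 -/

import Mathlib

namespace NoisyOT

noncomputable section

/-! ### Bit strings, subsets, probabilities, statistical distance, min-entropy -/

/-- Bit strings of length `n`. -/
abbrev Bits (n : ℕ) : Type := Fin n → Bool

/-- Bitwise exclusive or. -/
def bxor {n : ℕ} (a b : Bits n) : Bits n := fun j => xor (a j) (b j)

/-- The subsets of size `k` of a set with `n` elements. -/
abbrev Subset (n k : ℕ) : Type := {S : Finset (Fin n) // S.card = k}

theorem subset_nonempty {n k : ℕ} (h : k ≤ n) : Nonempty (Subset n k) := by
  obtain ⟨S, -, hS⟩ := Finset.exists_subset_card_eq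
    (s := (Finset.univ : Finset (Fin n))) (n := k) (by simpa using h)
  exact ⟨⟨S, hS⟩⟩

/-- `x^S`: the bits of `x` at the positions in `S`, in increasing order of the positions. -/
def restrict {n k : ℕ} (x : Bits n) (S : Subset n k) : Bits k :=
  fun j => x (S.1.orderEmbOfFin S.2 j)

/-- The uniform law on the `k`-subsets of an `n`-set. -/
def uniformSubset {n k : ℕ} (h : k ≤ n) : PMF (Subset n k) :=
  haveI := subset_nonempty h
  PMF.uniformOfFintype (Subset n k)

/-- The probability of an event. -/
def prob {Ω : Type} (P : PMF Ω) (E : Set Ω) : ℝ := (P.toOuterMeasure E).toReal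

/-- Statistical distance: the maximum over all events of the difference of the probabilities. -/
def statDist {Ω : Type} (P Q : PMF Ω) : ℝ := ⨆ E : Set Ω, |prob P E - prob Q E|

/-- Min-entropy in bits: `min_x (-log P(x)) = -log (max_x P(x))`. -/
def minEntropy {Ω : Type} (P : PMF Ω) : ℝ := -Real.logb 2 (⨆ x, (P x).toReal)

/-- Functions of the security parameter that decay faster than every inverse polynomial. -/
def Negligible (f : ℕ → ℝ) : Prop :=
  Asymptotics.SuperpolynomialDecay Filter.atTop (fun l : ℕ => (l : ℝ)) f

/-! ### Fuzzy extractors -/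

/-- The law of `(Y, R, P)` where `x` has law `X`, the seed `R` is uniform and `(Y, P)` is the
value of the extractor at `(x, R)`. -/
def extractLaw {n r m p : ℕ} (extract : Bits n → Bits r → Bits m × Bits p) (X : PMF (Bits n)) :
    PMF (Bits m × Bits r × Bits p) :=
  X.bind fun x => (PMF.uniformOfFintype (Bits r)).map fun s =>
    ((extract x s).1, s, (extract x s).2)

/-- The product of the uniform law on `m`-bit strings and the law of `(R, P)`. -/
def idealLaw {n r m p : ℕ} (extract : Bits n → Bits r → Bits m × Bits p) (X : PMF (Bits n)) :
    PMF (Bits m × Bits r × Bits p) :=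
  (PMF.uniformOfFintype (Bits m)).bind fun u => (extractLaw extract X).map fun v => (u, v.2)

/-- `(κ, ε, δ, β)`-fuzzy extractors. -/
structure IsFuzzyExtractor {n r m p : ℕ} (extract : Bits n → Bits r → Bits m × Bits p)
    (recover : Bits n → Bits r → Bits p → Bits m) (κ ε δ β : ℝ) : Prop where
  security : ∀ X : PMF (Bits n), κ ≤ minEntropy X →
    statDist (extractLaw extract X) (idealLaw extract X) ≤ ε
  recovery : ∀ x x' : Bits n, (hammingDist x x' : ℝ) ≤ δ * n →
    1 - β ≤ prob (PMF.uniformOfFintype (Bits r))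
      {s | recover x' s (extract x s).2 = (extract x s).1}

/-! ### Interactive hashing -/

/-- A two-party protocol of the interactive hashing format. In each round Alice sends a message
and Bob answers; both may depend on the own coins and on the messages so far, and Bob's also on
his input. In the end each party computes a pair `(W_0, W_1)`, written as a function on `Bool`
with `W_0` at `false` and `W_1` at `true`. -/
structure HashingProtocol (m : ℕ) where
  rounds : ℕ
  MsgA : Type
  MsgB : Type
  CoinsA : Type
  CoinsB : Type
  coinsA : PMF CoinsA
  coinsB : PMF CoinsB
  alice : CoinsA → List (MsgA × MsgB) → MsgA
  bob : Bits m → CoinsB → List (MsgA × MsgB) → MsgA → MsgB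
  outA : CoinsA → List (MsgA × MsgB) → Bool → Bits m
  outB : Bits m → CoinsB → List (MsgA × MsgB) → Bool → Bits m

namespace HashingProtocol

variable {m : ℕ}

abbrev Transcript (H : HashingProtocol m) : Type := List (H.MsgA × H.MsgB)

/-- A deterministic way to play Alice's part; a randomized one is a law on these. -/
abbrev PlayA (H : HashingProtocol m) : Type := H.Transcript → H.MsgA

/-- A deterministic way to play Bob's part; a randomized one is a law on these. -/
abbrev PlayB (H : HashingProtocol m) : Type := H.Transcript → H.MsgA → H.MsgB

/-- The messages of the first `j` rounds. -/
def transcript (H : HashingProtocol m) (a : H.PlayA) (b : H.PlayB) : ℕ → H.Transcript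
  | 0 => []
  | j + 1 =>
    let h := H.transcript a b j
    h ++ [(a h, b h (a h))]

/-- The transcript of a full run. -/
def run (H : HashingProtocol m) (a : H.PlayA) (b : H.PlayB) : H.Transcript :=
  H.transcript a b H.rounds

/-- The law of (view of Alice, `W`, Bob's output) if Alice plays the randomized strategy `A` and
Bob is honest with a uniform input `W`. Alice's view is the deterministic strategy that she has
drawn (that is, her coins) together with the transcript. -/
def lawA (H : HashingProtocol m) (A : PMF H.PlayA) :
    PMF ((H.PlayA × H.Transcript) × Bits m × (Bool → Bits m)) :=
  A.bind fun a => (PMF.uniformOfFintype (Bits m)).bind fun W => H.coinsB.map fun b =>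
    ((a, H.run a (H.bob W b)), W, H.outB W b (H.run a (H.bob W b)))

/-- The law of Alice's output if both parties are honest and Bob has input `W`. -/
def lawHonest (H : HashingProtocol m) (W : Bits m) : PMF (Bool → Bits m) :=
  H.coinsA.bind fun a => H.coinsB.map fun b => H.outA a (H.run (H.alice a) (H.bob W b))

/-- The law of the output of honest Alice if Bob plays the randomized strategy `B`. -/
def lawB (H : HashingProtocol m) (B : PMF H.PlayB) : PMF (Bool → Bits m) :=
  H.coinsA.bind fun a => B.map fun b => H.outA a (H.run (H.alice a) b)

/-- `η`-uniform `(t, θ)`-secure interactive hashing. -/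
structure IsSecure (H : HashingProtocol m) (η t θ : ℝ) : Prop where
  /-- Honest parties output the same two strings, in lexicographic order, one of them being
  Bob's input. -/
  correct : ∀ W, ∀ a ∈ H.coinsA.support, ∀ b ∈ H.coinsB.support,
    let T := H.run (H.alice a) (H.bob W b)
    H.outA a T = H.outB W b T ∧ toLex (H.outA a T false) < toLex (H.outA a T true) ∧
      ∃ d, H.outA a T d = W
  /-- Alice's view has the same law conditioned on `W = W_0` as conditioned on `W = W_1` (written
  without denominators). -/
  view_indep : ∀ (A : PMF H.PlayA) (E : Set (H.PlayA × H.Transcript)),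
    prob (H.lawA A) {v | v.1 ∈ E ∧ v.2.1 = v.2.2 false} *
        prob (H.lawA A) {v | v.2.1 = v.2.2 true} =
      prob (H.lawA A) {v | v.1 ∈ E ∧ v.2.1 = v.2.2 true} *
        prob (H.lawA A) {v | v.2.1 = v.2.2 false}
  /-- For honest parties the output other than `W` is `η`-close to uniform on the `2^m - 1`
  strings different from `W`. -/
  uniform : ∀ (W : Bits m) (T : Finset (Bits m)), W ∉ T →
    |prob (H.lawHonest W) {V | ∃ d, V d = W ∧ V (!d) ∈ T} - T.card / (2 ^ m - 1)| ≤ η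
  /-- A malicious Bob can force both outputs into a small set with probability at most `θ`. -/
  binding : ∀ T : Finset (Bits m), (T.card : ℝ) ≤ (2 : ℝ) ^ t → ∀ B : PMF H.PlayB,
    prob (H.lawB B) {V | V false ∈ T ∧ V true ∈ T} ≤ θ

end HashingProtocol

/-! ### The oblivious transfer protocol -/

/-- The public data of the protocol for security parameter `l`: the length `n` of the source, the
number `k` of sampled positions, the length `m` of the encodings, the seed length `r`, the length
`q` of the secrets and of the extracted strings, the length `p` of the helper strings, the
interactive hashing protocol, the dense encoding of `l`-subsets of a `k`-set, and the two functions
of the fuzzy extractor. -/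
structure OTProtocol (l : ℕ) where
  n : ℕ
  k : ℕ
  m : ℕ
  r : ℕ
  q : ℕ
  p : ℕ
  k_le : k ≤ n
  hashing : HashingProtocol m
  /-- Each `l`-subset has `⌊2^m / binom k l⌋` encodings; by counting, injectivity implies that
  fewer than `binom k l` strings are not valid encodings. -/
  encode : Subset k l × Fin (2 ^ m / k.choose l) → Bits m
  encode_injective : Function.Injective encode
  extract : Bits l → Bits r → Bits q × Bits p
  recover : Bits l → Bits r → Bits p → Bits q

namespace OTProtocol

variable {l : ℕ}

/-- The subset encoded by a string, or `none` if the string is not a valid encoding. -/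
def decode (P : OTProtocol l) (W : Bits P.m) : Option (Subset P.k l) :=
  (Function.partialInv P.encode W).map Prod.fst

/-- What Bob may keep of the source: a string of at most `γ n` bits. -/
abbrev Memory (P : OTProtocol l) (γ : ℝ) : Type := {w : List Bool // (w.length : ℝ) ≤ γ * P.n}

/-- A strategy of a malicious Bob with storage rate `γ`. He draws his local randomness, computes
from it, his choice bit and his version of the source what he stores, and forgets the source. Later
he is unbounded. He learns Alice's set of positions, plays his part of interactive hashing
arbitrarily, and, once `(W_0, W_1)` is determined, sends a bit `e`, or aborts (`none`). The first
argument of the functions is his input, the choice bit. -/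
structure BobStrategy (P : OTProtocol l) (γ : ℝ) where
  Coins : Type
  coins : PMF Coins
  store : Bool → Coins → Bits P.n → P.Memory γ
  hash : Bool → Coins → P.Memory γ → Subset P.n P.k → P.hashing.PlayB
  reply : Bool → Coins → P.Memory γ → Subset P.n P.k → P.hashing.Transcript →
    (Bool → Bits P.m) → Option Bool

variable {P : OTProtocol l} {γ : ℝ}

/-- Bob's view at the end of the setup stage: local randomness, stored string, Alice's positions,
transcript of interactive hashing and the strings `W_0, W_1`. -/
structure SetupView (B : P.BobStrategy γ) where
  coins : B.Coins
  memory : P.Memory γ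
  positions : Subset P.n P.k
  messages : P.hashing.Transcript
  W : Bool → Bits P.m

/-- The messages `(Z_j, R_j, P_j)`, `j ∈ {0, 1}`, of the transfer stage; `none` after an abort. -/
abbrev TransferMessage (P : OTProtocol l) : Type :=
  Option (Bool → Bits P.q × Bits P.r × Bits P.p)

/-- The message of honest Alice in the transfer stage if her source is `x`, her seeds are `R`, her
secrets are `(s_0, s_1)`, and Bob has input `c` and setup view `v`. -/
def aliceTransfer (B : P.BobStrategy γ) (c : Bool) (x : Bits P.n) (R : Bool → Bits P.r)
    (s : Bool → Bits P.q) (v : SetupView B) : P.TransferMessage :=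
  match B.reply c v.coins v.memory v.positions v.messages v.W,
      P.decode (v.W false), P.decode (v.W true) with
  | some e, some C₀, some C₁ => some fun j =>
      let C := if j then C₁ else C₀
      let Y := P.extract (restrict (restrict x v.positions) C) (R j)
      (bxor (s (xor j e)) Y.1, R j, Y.2)
  | _, _, _ => none

/-- Bob's view of the whole protocol with honest Alice, where `source` is the joint law of Alice's
and Bob's version of the source. The secrets are used only after the setup stage; `s` gives them as
a function of Bob's setup view (a constant function for secrets fixed in advance). -/
def view (B : P.BobStrategy γ) (c : Bool) (source : PMF (Bits P.n × Bits P.n))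
    (s : SetupView B → Bool → Bits P.q) : PMF (SetupView B × P.TransferMessage) :=
  source.bind fun x => B.coins.bind fun ω => (uniformSubset P.k_le).bind fun A =>
    P.hashing.coinsA.bind fun a => (PMF.uniformOfFintype (Bool → Bits P.r)).map fun R =>
      let M := B.store c ω x.2
      let T := P.hashing.run (P.hashing.alice a) (B.hash c ω M A)
      let v : SetupView B := ⟨ω, M, A, T, P.hashing.outA a T⟩
      (v, aliceTransfer B c x.1 R (s v) v)

/-- `lam`-security for Alice: for all sources of min-entropy at least `α n` for Alice, all versions
of it for Bob within Hamming distance `δ n`, and all strategies of Bob with storage rate `γ` and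
all inputs `c`, there is an index `i`, determined by Bob's view of the setup stage, such that any
two `i`-consistent pairs of secrets give rise to views of Bob that are `lam`-close. -/
def SecureForAlice (P : OTProtocol l) (α γ δ lam : ℝ) : Prop :=
  ∀ source : PMF (Bits P.n × Bits P.n),
    α * P.n ≤ minEntropy (source.map Prod.fst) →
    (∀ x ∈ source.support, (hammingDist x.1 x.2 : ℝ) ≤ δ * P.n) →
    ∀ (B : P.BobStrategy γ) (c : Bool), ∃ i : SetupView B → Bool,
      ∀ s s' : SetupView B → Bool → Bits P.q, (∀ v, s v (i v) = s' v (i v)) →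
        statDist (view B c source s) (view B c source s') ≤ lam

end OTProtocol

/-! ### Parameters -/

/-- `ρ = α - γ - (1 + log (1/ε')) / n`. -/
def rho (α γ ε' : ℝ) (n : ℕ) : ℝ := α - γ - (1 + Real.logb 2 (1 / ε')) / n

/-- `ν = τ / log (1/τ)`. -/
def nu (τ : ℝ) : ℝ := τ / Real.logb 2 (1 / τ)

/-- `ε'' = exp (-l ν² / 2) + 2 ^ (-c τ n)`. -/
def epsSample (τ c : ℝ) (l n : ℕ) : ℝ :=
  Real.exp (-(l * nu τ ^ 2 / 2)) + (2 : ℝ) ^ (-(c * τ * n))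

/-- `k_F = ρ + R - 3 τ - 2 m_F - 1 - (1 + log (1/ε̂)) / l`. -/
def kF (ρ R τ mF εhat : ℝ) (l : ℕ) : ℝ :=
  ρ + R - 3 * τ - 2 * mF - 1 - (1 + Real.logb 2 (1 / εhat)) / l

/-- The requirements on the protocol with security parameter `l`. -/
structure OTProtocol.Admissible {l : ℕ} (P : OTProtocol l)
    (α γ δ ξ τ ζ c R mF t ε' εhat εF θ : ℝ) : Prop where
  n_pos : 0 < P.n
  k_eq : P.k = ⌈2 * Real.sqrt (l * P.n)⌉₊
  α_pos : 0 < α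
  α_lt_one : α < 1
  γ_lt : γ < α
  δ_nonneg : 0 ≤ δ
  ξ_pos : 0 < ξ
  τ_le : 3 * τ ≤ rho α γ ε' P.n
  mF_pos : 0 < mF
  mF_lt_one : mF < 1
  q_eq : (P.q : ℝ) = mF * l
  p_eq : (P.p : ℝ) = (1 - R) * l
  fuzzy : IsFuzzyExtractor P.extract P.recover
    (kF (rho α γ ε' P.n) R τ mF εhat l * l) εF (δ + ξ) 0
  m_ge : 2 * l * Real.logb 2 P.k ≤ P.m
  t_ge : P.m - ζ * Real.logb 2 (1 / (ε' + epsSample τ c l P.n)) ≤ t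
  hashing : P.hashing.IsSecure (2 ^ (-(P.m : ℝ))) t θ

end

end NoisyOT

namespace NoisyOT

/-! Fix Bob's coins and put D = exp(-lν²/2). Stored strings w of probability below ε'·2^(-(γn+1))
occur with total probability at most ε', as there are at most 2^(γn+1) strings; given any other w, X
has min-entropy at least ρn (`condSource_le`). Min-entropy sampling (`sum_not_spread_le`) shows that
X^S, for most l-subsets S of [n], keeps the rate ρ - 3τ outside an event of small probability. An
l-subset of a random A is a random l-subset of [n], so two uses of Markov's inequality
(`card_many_badSubsets_le`) show that, for most A, at most a fraction D^ζ of the subsets of A is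
bad, that is, has exceptional mass above η.

The bad subsets are fixed before interactive hashing and have at most D^ζ·2^m ≤ 2^t encodings. By
the binding property some C_g is therefore good, except with probability θ, and the secret encrypted
with the key from C_g stays hidden. The other subset may overlap C_g, so its key and helper string
are treated as a leak of q + p bits. Leak values too rare to leave a k_F l-source have total mass at
most ε̂; for the others the fuzzy extractor yields a nearly ideal one-time pad
(`sum_cipherProb_leak_le`, `sum_transfer_le`).

For the sampling, the law of X given w is factored by the chain rule into conditional bit
probabilities. If their product over S is at most K, no value of X^S collects more than mass K
(`sum_spread_le`). Raising each factor to at least τ bounds its logarithm at little cost, and a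
Chernoff bound without replacement, derived from Maclaurin's inequality, compares the product over S
with the product over all positions (`card_heavy_subsets_le`). -/

/-! ### Maclaurin's inequality and sums over prefix trees. -/

theorem pow_tangent_le {a b : ℝ} (ha : 0 ≤ a) (hb : 0 ≤ b) (l : ℕ) :
    a ^ (l + 1) + (l + 1) * (b - a) * a ^ l ≤ b ^ (l + 1) := by
  induction l with
  | zero => simp
  | succ l ih =>
    have h1 := mul_le_mul_of_nonneg_left ih hb
    have h2 : 0 ≤ ((l : ℝ) + 1) * (b - a) ^ 2 * a ^ l := by positivity
    have h3 : b ^ (l + 1 + 1) = b * b ^ (l + 1) := by ring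
    rw [h3]
    refine le_trans ?_ h1
    push_cast
    have : b * (a ^ (l + 1) + (l + 1) * (b - a) * a ^ l) -
      (a ^ (l + 1 + 1) + (l + 1 + 1) * (b - a) * a ^ (l + 1)) =
        ((l : ℝ) + 1) * (b - a) ^ 2 * a ^ l := by ring
    linarith

/-- Maclaurin's inequality between the elementary symmetric means and the arithmetic mean. -/
theorem sum_powersetCard_prod_le {ι : Type*} [DecidableEq ι] (s : Finset ι) (y : ι → ℝ)
    (hy : ∀ i, 0 ≤ y i) (l : ℕ) :
    ∑ S ∈ s.powersetCard l, ∏ i ∈ S, y i ≤ s.card.choose l * ((∑ i ∈ s, y i) / s.card) ^ l := by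
  induction s using Finset.induction_on generalizing l with
  | empty =>
    cases l with
    | zero => simp
    | succ l => rw [Finset.powersetCard_eq_empty.2 (by simp)]; simp
  | insert a s ha ih =>
    cases l with
    | zero => simp
    | succ l =>
      have hinj : Set.InjOn (insert a) (s.powersetCard l : Set (Finset ι)) := by
        intro S hS T hT h
        have hS' : a ∉ S := fun h' => ha ((Finset.mem_powersetCard.1 hS).1 h')
        have hT' : a ∉ T := fun h' => ha ((Finset.mem_powersetCard.1 hT).1 h')
        rw [← Finset.erase_insert hS', ← Finset.erase_insert hT', h]
      have hdisj : Disjoint (s.powersetCard (l + 1)) ((s.powersetCard l).image (insert a)) := by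
        rw [Finset.disjoint_left]
        intro S hS hS'
        obtain ⟨T, -, rfl⟩ := Finset.mem_image.1 hS'
        exact ha ((Finset.mem_powersetCard.1 hS).1 (Finset.mem_insert_self a T))
      rw [Finset.powersetCard_succ_insert ha, Finset.sum_union hdisj, Finset.sum_image hinj,
        Finset.sum_insert ha, Finset.card_insert_of_notMem ha]
      have h1 : ∑ S ∈ s.powersetCard l, ∏ i ∈ insert a S, y i =
          y a * ∑ S ∈ s.powersetCard l, ∏ i ∈ S, y i := by
        rw [Finset.mul_sum]
        refine Finset.sum_congr rfl fun S hS => ?_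
        exact Finset.prod_insert fun h' => ha ((Finset.mem_powersetCard.1 hS).1 h')
      rw [h1]
      have i1 := ih (l + 1)
      have i2 := mul_le_mul_of_nonneg_left (ih l) (hy a)
      obtain ⟨N, hN⟩ : ∃ N, N = s.card := ⟨_, rfl⟩
      rw [← hN] at i1 i2 ⊢
      set t := ∑ i ∈ s, y i with ht
      have ht0 : 0 ≤ t := Finset.sum_nonneg fun i _ => hy i
      set μ := t / N with hμ
      have hμ0 : 0 ≤ μ := by positivity
      have hNμ : t = N * μ := by
        rcases Nat.eq_zero_or_pos N with h0 | h0
        · have : s = ∅ := Finset.card_eq_zero.1 (hN ▸ h0)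
          rw [h0, Nat.cast_zero, zero_mul, ht, this, Finset.sum_empty]
        · have : (N : ℝ) ≠ 0 := Nat.cast_ne_zero.2 h0.ne'
          rw [hμ, mul_div_assoc', mul_div_cancel_left₀ _ this]
      set b := (y a + t) / ((N + 1 : ℕ) : ℝ) with hb
      have hb0 : 0 ≤ b := div_nonneg (add_nonneg (hy a) ht0) (by positivity)
      clear_value b μ t
      have hbμ : (N + 1 : ℝ) * (b - μ) = y a - μ := by
        have : (N + 1 : ℝ) ≠ 0 := Nat.cast_add_one_ne_zero N
        rw [hb, hNμ]; push_cast; field_simp; ring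
      -- The power at the new mean b is bounded below by its tangent at the old mean μ. As (N + 1)(b
      -- - μ) = y a - μ, the tangent value is exactly the sum of the two bounds given by the
      -- induction hypothesis.
      have hB := mul_le_mul_of_nonneg_left (pow_tangent_le hμ0 hb0 l)
        (Nat.cast_nonneg (α := ℝ) ((N + 1).choose (l + 1)))
      have c1 : ((N + 1 : ℝ)) * N.choose l = (N + 1).choose (l + 1) * (l + 1) := by
        exact_mod_cast Nat.add_one_mul_choose_eq N l
      have c2 : ((N + 1).choose (l + 1) : ℝ) = N.choose l + N.choose (l + 1) := by
        exact_mod_cast Nat.choose_succ_succ N l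
      have e : ((N + 1).choose (l + 1) : ℝ) * (μ ^ (l + 1) + (l + 1) * (b - μ) * μ ^ l) =
          N.choose (l + 1) * μ ^ (l + 1) + y a * (N.choose l * μ ^ l) := by
        have : ((N + 1).choose (l + 1) : ℝ) * (l + 1) * (b - μ) = N.choose l * (y a - μ) := by
          rw [← c1, ← hbμ]; ring
        calc _ = ((N + 1).choose (l + 1) : ℝ) * μ ^ (l + 1) +
              (((N + 1).choose (l + 1) : ℝ) * (l + 1) * (b - μ)) * μ ^ l := by ring
          _ = _ := by rw [this, c2]; ring
      linarith

/-- A sum over bit strings of products of factors that depend on prefixes only. -/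
theorem sum_prod_prefix_le {n : ℕ} (g : Fin n → Bits n → ℝ) (B : Fin n → ℝ)
    (hg : ∀ i x, 0 ≤ g i x) (hB0 : ∀ i, 0 ≤ B i)
    (hdep : ∀ i x x', (∀ j ≤ i, x j = x' j) → g i x = g i x')
    (hB : ∀ i x, g i (Function.update x i false) + g i (Function.update x i true) ≤ B i) :
    ∑ x, ∏ i, g i x ≤ ∏ i, B i := by
  induction n with
  | zero => simp
  | succ n ih =>
    -- Only the last factor sees the last bit. The others are evaluated with that bit set to
    -- `false`, so that the sum over it can be carried out first.
    have key : ∀ (x : Bits n) (b : Bool) (i : Fin n),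
        g i.castSucc (Fin.snoc x b : Bits (n + 1)) = g i.castSucc (Fin.snoc x false : Bits (n + 1)) := by
      intro x b i
      refine hdep _ _ _ fun j hj => ?_
      have hj' : j.1 < n := lt_of_le_of_lt (Fin.le_def.1 hj) i.2
      have : j = Fin.castSucc ⟨j.1, hj'⟩ := rfl
      rw [this, Fin.snoc_castSucc (α := fun _ => Bool), Fin.snoc_castSucc (α := fun _ => Bool)]
    have hlast : ∀ x : Bits n, ∑ b, g (Fin.last n) (Fin.snoc x b : Bits (n + 1)) ≤ B (Fin.last n) := by
      intro x
      have := hB (Fin.last n) (Fin.snoc x false : Bits (n + 1))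
      rw [Fin.update_snoc_last, Fin.update_snoc_last] at this
      rw [Fintype.sum_bool]; linarith
    have e : ∑ x, ∏ i, g i x = ∑ x : Bits n, ∑ b : Bool,
        (∏ i : Fin n, g i.castSucc (Fin.snoc x false : Bits (n + 1))) *
          g (Fin.last n) (Fin.snoc x b : Bits (n + 1)) := by
      rw [← (Fin.snocEquiv fun _ : Fin (n + 1) => Bool).sum_comp, Fintype.sum_prod_type,
        Finset.sum_comm]
      refine Finset.sum_congr rfl fun x _ => Finset.sum_congr rfl fun b _ => ?_
      rw [Fin.prod_univ_castSucc]
      congr 1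
      exact Finset.prod_congr rfl fun i _ => key x b i
    rw [e, Fin.prod_univ_castSucc]
    have hih := ih (fun i x => g i.castSucc (Fin.snoc x false : Bits (n + 1))) (fun i => B i.castSucc)
      (fun i x => hg _ _) (fun i => hB0 _)
      (fun i x x' h => by
        refine hdep _ _ _ fun j hj => ?_
        have hj' : j.1 < n := lt_of_le_of_lt (Fin.le_def.1 hj) i.2
        have : j = Fin.castSucc ⟨j.1, hj'⟩ := rfl
        rw [this, Fin.snoc_castSucc (α := fun _ => Bool), Fin.snoc_castSucc (α := fun _ => Bool)]
        exact h _ (Fin.le_def.2 (Fin.le_def.1 hj)))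
      (fun i x => by
        have := hB i.castSucc (Fin.snoc x false : Bits (n + 1))
        rwa [← Fin.snoc_update, ← Fin.snoc_update] at this)
    calc _ = ∑ x : Bits n, (∏ i : Fin n, g i.castSucc (Fin.snoc x false : Bits (n + 1))) *
          ∑ b, g (Fin.last n) (Fin.snoc x b : Bits (n + 1)) := by
            simp only [Finset.mul_sum]
      _ ≤ ∑ x : Bits n, (∏ i : Fin n, g i.castSucc (Fin.snoc x false : Bits (n + 1))) *
          B (Fin.last n) := Finset.sum_le_sum fun x _ =>
            mul_le_mul_of_nonneg_left (hlast x) (Finset.prod_nonneg fun i _ => hg _ _)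
      _ ≤ _ := by
        rw [← Finset.sum_mul]
        exact mul_le_mul_of_nonneg_right hih (hB0 _)

/-! ### The chain rule and spread strings. -/

noncomputable section

/-- The mass of the strings that agree with `x` before position `j`. -/
def prefixMass {n : ℕ} (Q : Bits n → ℝ) (j : ℕ) (x : Bits n) : ℝ :=
  ∑ x', if ∀ i : Fin n, i.1 < j → x' i = x i then Q x' else 0

/-- The conditional probability of the `i`-th bit of `x` given the bits before. -/
def chainProb {n : ℕ} (Q : Bits n → ℝ) (i : Fin n) (x : Bits n) : ℝ :=
  prefixMass Q (i + 1) x / prefixMass Q i x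

variable {n : ℕ} {Q : Bits n → ℝ}

theorem prefixMass_nonneg (hQ : ∀ x, 0 ≤ Q x) (j : ℕ) (x : Bits n) : 0 ≤ prefixMass Q j x :=
  Finset.sum_nonneg fun x' _ => by split_ifs <;> [exact hQ x'; rfl]

theorem prefixMass_congr {j : ℕ} {x x' : Bits n} (h : ∀ i : Fin n, i.1 < j → x i = x' i) :
    prefixMass Q j x = prefixMass Q j x' := by
  unfold prefixMass
  refine Finset.sum_congr rfl fun y _ => if_congr ?_ rfl rfl
  exact forall₂_congr fun i hi => by rw [h i hi]

theorem prefixMass_update (i : Fin n) (x : Bits n) :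
    prefixMass Q (i + 1) (Function.update x i false) +
      prefixMass Q (i + 1) (Function.update x i true) = prefixMass Q i x := by
  unfold prefixMass
  rw [← Finset.sum_add_distrib]
  refine Finset.sum_congr rfl fun y _ => ?_
  have h : ∀ b, (∀ j : Fin n, j.1 < i.1 + 1 → y j = Function.update x i b j) ↔
      (∀ j : Fin n, j.1 < i.1 → y j = x j) ∧ y i = b := by
    intro b
    constructor
    · intro h
      refine ⟨fun j hj => ?_, by simpa using h i (Nat.lt_succ_self _)⟩
      have := h j (by omega)
      rwa [Function.update_of_ne (by rintro rfl; omega)] at this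
    · rintro ⟨h, h'⟩ j hj
      by_cases hji : j = i
      · subst hji; simpa using h'
      · rw [Function.update_of_ne hji]
        exact h j (by have := fun h'' => hji (Fin.ext h''); omega)
  rw [if_congr (h false) rfl rfl, if_congr (h true) rfl rfl]
  cases y i <;> simp

theorem prefixMass_succ_le (hQ : ∀ x, 0 ≤ Q x) (i : Fin n) (x : Bits n) :
    prefixMass Q (i + 1) x ≤ prefixMass Q i x := by
  unfold prefixMass
  refine Finset.sum_le_sum fun y _ => ?_
  split_ifs with h1 h2 h2
  · exact le_rfl
  · exact absurd (fun j hj => h1 j (by omega)) h2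
  · exact hQ y
  · exact le_rfl

theorem chainProb_nonneg (hQ : ∀ x, 0 ≤ Q x) (i : Fin n) (x : Bits n) : 0 ≤ chainProb Q i x :=
  div_nonneg (prefixMass_nonneg hQ _ _) (prefixMass_nonneg hQ _ _)

theorem chainProb_le_one (hQ : ∀ x, 0 ≤ Q x) (i : Fin n) (x : Bits n) : chainProb Q i x ≤ 1 :=
  div_le_one_of_le₀ (prefixMass_succ_le hQ i x) (prefixMass_nonneg hQ _ _)

theorem chainProb_congr {i : Fin n} {x x' : Bits n} (h : ∀ j ≤ i, x j = x' j) :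
    chainProb Q i x = chainProb Q i x' := by
  unfold chainProb
  rw [prefixMass_congr (x := x) (x' := x') fun j hj => h j (Fin.le_def.2 (by omega)),
    prefixMass_congr (x := x) (x' := x') fun j hj => h j (Fin.le_def.2 (by omega))]

theorem chainProb_update_add (i : Fin n) (x : Bits n) :
    chainProb Q i (Function.update x i false) + chainProb Q i (Function.update x i true) ≤ 1 := by
  unfold chainProb
  have h : ∀ b, prefixMass Q i (Function.update x i b) = prefixMass Q i x := fun b =>
    prefixMass_congr fun j hj => Function.update_of_ne (by rintro rfl; omega) _ _
  rw [h, h, ← add_div, prefixMass_update]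
  exact div_self_le_one _

/-- The product telescopes from the total mass 1 to the mass of x alone. A vanishing denominator
does no harm, since prefix masses decrease with the length of the prefix. -/
theorem prod_chainProb (hQ : ∀ x, 0 ≤ Q x) (hQ1 : ∑ x, Q x = 1) (x : Bits n) :
    ∏ i, chainProb Q i x = Q x := by
  have h : ∀ j (hj : j ≤ n), ∏ i : Fin j, chainProb Q (Fin.castLE hj i) x = prefixMass Q j x := by
    intro j
    induction j with
    | zero => intro _; simp [prefixMass, hQ1]
    | succ j ih =>
      intro hj
      rw [Fin.prod_univ_castSucc]
      have := ih (by omega)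
      have e : ∏ i : Fin j, chainProb Q (Fin.castLE hj i.castSucc) x = prefixMass Q j x := this
      rw [e]
      have hle := prefixMass_succ_le hQ ⟨j, hj⟩ x
      have h0 := prefixMass_nonneg hQ (j + 1) x
      change prefixMass Q j x * (prefixMass Q (j + 1) x / prefixMass Q j x) = _
      by_cases hz : prefixMass Q j x = 0
      · change prefixMass Q (j + 1) x ≤ prefixMass Q j x at hle
        rw [hz] at hle ⊢; linarith
      · field_simp
  have := h n le_rfl
  simp only [Fin.castLE_rfl, id] at this
  rw [this, prefixMass]
  rw [Finset.sum_eq_single x]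
  · simp
  · intro y _ hy
    rw [if_neg]
    exact fun h => hy (funext fun i => h i i.2)
  · simp

/-- The strings to which a position set `S` assigns conditional probability at most `K`. -/
def spread (Q : Bits n → ℝ) (K : ℝ) (S : Finset (Fin n)) : Finset (Bits n) :=
  {x | ∏ i ∈ S, chainProb Q i x ≤ K}

/-- Q x is the product of the factors in S, at most K on spread strings, and of those outside S.
With the bits in S frozen to z, the latter products sum to at most 1, by summing over the bits from
the last to the first. -/
theorem sum_spread_le (hQ : ∀ x, 0 ≤ Q x) (hQ1 : ∑ x, Q x = 1) {K : ℝ} (hK : 0 ≤ K)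
    (S : Finset (Fin n)) (z : Bits n) :
    ∑ x ∈ spread Q K S with ∀ i ∈ S, x i = z i, Q x ≤ K := by
  set g : Fin n → Bits n → ℝ := fun i x =>
    if i ∈ S then (if x i = z i then 1 else 0) else chainProb Q i x with hg
  have g0 : ∀ i x, 0 ≤ g i x := by
    intro i x
    simp only [hg]
    split_ifs <;> first | exact zero_le_one | exact le_rfl | exact chainProb_nonneg hQ i x
  have h1 : ∑ x, ∏ i, g i x ≤ ∏ _i : Fin n, (1 : ℝ) := by
    refine sum_prod_prefix_le g (fun _ => 1) g0 (fun _ => zero_le_one) ?_ ?_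
    · intro i x x' h
      simp only [hg, h i le_rfl, chainProb_congr h]
    · intro i x
      by_cases hi : i ∈ S
      · simp only [hg, if_pos hi, Function.update_self]
        cases z i <;> simp
      · simp only [hg, if_neg hi]
        exact chainProb_update_add i x
  rw [Finset.prod_const_one] at h1
  calc _ ≤ ∑ x ∈ spread Q K S with ∀ i ∈ S, x i = z i, K * ∏ i, g i x := by
        refine Finset.sum_le_sum fun x hx => ?_
        obtain ⟨hx1, hx2⟩ := Finset.mem_filter.1 hx
        have hx1 := (Finset.mem_filter.1 hx1).2
        have e1 : ∏ i, g i x = ∏ i ∈ Sᶜ, chainProb Q i x := by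
          rw [← Finset.prod_mul_prod_compl S]
          rw [Finset.prod_eq_one, one_mul]
          · refine Finset.prod_congr rfl fun i hi => ?_
            simp only [hg, if_neg (Finset.mem_compl.1 hi)]
          · intro i hi
            simp only [hg, if_pos hi, if_pos (hx2 i hi)]
        rw [e1, ← prod_chainProb hQ hQ1 x, ← Finset.prod_mul_prod_compl S]
        exact mul_le_mul_of_nonneg_right hx1 (Finset.prod_nonneg fun i _ => chainProb_nonneg hQ i x)
    _ ≤ ∑ x, K * ∏ i, g i x := Finset.sum_le_sum_of_subset_of_nonneg (Finset.subset_univ _)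
        fun x _ _ => mul_nonneg hK (Finset.prod_nonneg fun i _ => g0 i x)
    _ ≤ K := by
        rw [← Finset.mul_sum]
        exact mul_le_of_le_one_right hK h1

/-- After truncation at τ the two branches of a bit sum to at most 1 + τ. In exchange every factor
has -log at most log(1/τ), which the Chernoff bound needs. -/
theorem sum_prod_max_chainProb_le (hQ : ∀ x, 0 ≤ Q x) {τ : ℝ} (hτ : 0 ≤ τ) (hτ1 : τ ≤ 1) :
    ∑ x, ∏ i, max (chainProb Q i x) τ ≤ (1 + τ) ^ n := by
  have := sum_prod_prefix_le (fun i x => max (chainProb Q i x) τ) (fun _ : Fin n => 1 + τ)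
    (fun i x => le_max_of_le_right hτ) (fun _ => by positivity)
    (fun i x x' h => by simp only [chainProb_congr h])
    (fun i x => by
      have h1 := chainProb_update_add (Q := Q) i x
      have h2 := chainProb_nonneg hQ i (Function.update x i false)
      have h3 := chainProb_nonneg hQ i (Function.update x i true)
      rcases max_cases (chainProb Q i (Function.update x i false)) τ with h | h <;>
      rcases max_cases (chainProb Q i (Function.update x i true)) τ with h' | h' <;>
      linarith)
  simpa using this

end

/-! ### Min-entropy sampling. -/

theorem exp_neg_le_quadratic {x : ℝ} (hx : 0 ≤ x) : Real.exp (-x) ≤ 1 - x + x ^ 2 / 2 := by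
  have h := Real.quadratic_le_exp_of_nonneg hx
  have h1 : Real.exp (-x) * Real.exp x = 1 := by rw [← Real.exp_add]; simp
  have h2 := mul_le_mul_of_nonneg_left h (Real.exp_pos (-x)).le
  have h3 : 0 < 1 + x + x ^ 2 / 2 := by positivity
  have h4 : Real.exp (-x) * (1 + x + x ^ 2 / 2) ≤ (1 - x + x ^ 2 / 2) * (1 + x + x ^ 2 / 2) := by
    have : (1 - x + x ^ 2 / 2) * (1 + x + x ^ 2 / 2) = 1 + x ^ 4 / 4 := by ring
    have : 0 ≤ x ^ 4 := by positivity
    linarith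
  exact le_of_mul_le_mul_right h4 h3

theorem two_rpow_eq_exp (a : ℝ) : (2 : ℝ) ^ a = Real.exp (Real.log 2 * a) :=
  Real.rpow_def_of_pos two_pos a

theorem one_le_logb_inv {τ : ℝ} (h0 : 0 < τ) (h1 : τ < 1 / 3) : 1 ≤ Real.logb 2 (1 / τ) := by
  rw [Real.le_logb_iff_rpow_le one_lt_two (by positivity), Real.rpow_one, le_div_iff₀ h0]
  linarith

/-- The left side is at most exp(-(2 log 2 - 1)τn). Since n ≥ 4l, this is below exp(-1.5 τl), while
ν² ≤ τ² ≤ τ/3 makes the target at least exp(-τl/6). -/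
theorem two_rpow_mul_pow_le {τ : ℝ} (h0 : 0 < τ) (h1 : τ < 1 / 3) {l n : ℕ} (hln : 4 * l ≤ n) :
    (2 : ℝ) ^ (-(2 * τ * n)) * (1 + τ) ^ n ≤ Real.exp (-(l * nu τ ^ 2 / 2)) := by
  have hn : (1 + τ) ^ n ≤ Real.exp (n * τ) := by
    rw [Real.exp_nat_mul]
    exact pow_le_pow_left₀ (by positivity) (by linarith [Real.add_one_le_exp τ]) _
  have hL := one_le_logb_inv h0 h1
  have hnu : nu τ ≤ τ := div_le_self h0.le hL
  have hnu0 : 0 ≤ nu τ := div_nonneg h0.le (by linarith)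
  have hnu2 : nu τ ^ 2 ≤ τ / 3 := by nlinarith
  have hlog := Real.log_two_gt_d9
  have hln' : (4 : ℝ) * l ≤ n := by exact_mod_cast hln
  rw [two_rpow_eq_exp]
  refine (mul_le_mul_of_nonneg_left hn (Real.exp_pos _).le).trans ?_
  rw [← Real.exp_add, Real.exp_le_exp]
  have hl0 : (0 : ℝ) ≤ l := Nat.cast_nonneg l
  have e1 : (l : ℝ) * nu τ ^ 2 / 2 ≤ l * τ / 6 := by
    have := mul_le_mul_of_nonneg_left hnu2 hl0
    linarith
  have e2 : 4 * (l * τ) ≤ n * τ := by nlinarith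
  have e3 : 0 ≤ (n * τ) * (Real.log 2 - 0.6931471803) := by
    have : 0 ≤ n * τ := by positivity
    exact mul_nonneg this (by linarith)
  have e4 : 0 ≤ l * τ := by positivity
  nlinarith

variable {n : ℕ} {Q : Bits n → ℝ}

/-- A change of measure: on the strings in the sum, Q x ≤ 2^(-ρn) is at most 2^(-2τn) times the
truncated product, and these products have total at most (1 + τ)^n. -/
theorem sum_atypical_le (hQ : ∀ x, 0 ≤ Q x) {τ ρ : ℝ} (h0 : 0 < τ) (h1 : τ < 1 / 3)
    (hmin : ∀ x, Q x ≤ (2 : ℝ) ^ (-(ρ * n))) {l : ℕ} (hln : 4 * l ≤ n) :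
    ∑ x with (2 : ℝ) ^ (-((ρ - 2 * τ) * n)) < ∏ i, max (chainProb Q i x) τ, Q x ≤
      Real.exp (-(l * nu τ ^ 2 / 2)) := by
  refine le_trans ?_ (two_rpow_mul_pow_le h0 h1 hln)
  calc _ ≤ ∑ x with (2 : ℝ) ^ (-((ρ - 2 * τ) * n)) < ∏ i, max (chainProb Q i x) τ,
        (2 : ℝ) ^ (-(2 * τ * n)) * ∏ i, max (chainProb Q i x) τ := by
        refine Finset.sum_le_sum fun x hx => ?_
        have hx := (Finset.mem_filter.1 hx).2
        refine (hmin x).trans ?_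
        have : (2 : ℝ) ^ (-(ρ * n)) =
            (2 : ℝ) ^ (-(2 * τ * n)) * (2 : ℝ) ^ (-((ρ - 2 * τ) * n)) := by
          rw [← Real.rpow_add two_pos]; congr 1; ring
        rw [this]
        exact mul_le_mul_of_nonneg_left hx.le (by positivity)
    _ ≤ ∑ x, (2 : ℝ) ^ (-(2 * τ * n)) * ∏ i, max (chainProb Q i x) τ :=
        Finset.sum_le_sum_of_subset_of_nonneg (Finset.filter_subset _ _) fun x _ _ =>
          mul_nonneg (by positivity) (Finset.prod_nonneg fun i _ => le_max_of_le_right h0.le)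
    _ ≤ _ := by
        rw [← Finset.mul_sum]
        exact mul_le_mul_of_nonneg_left (sum_prod_max_chainProb_le hQ h0.le (by linarith))
          (by positivity)

/-- A Chernoff bound for sampling without replacement, in multiplicative form. -/
theorem card_heavy_subsets_le {τ ρ : ℝ} (h0 : 0 < τ) (h1 : τ < 1 / 3) (hn : 0 < n) (l : ℕ)
    (y : Fin n → ℝ) (hy : ∀ i, τ ≤ y i) (hy1 : ∀ i, y i ≤ 1)
    (hprod : ∏ i, y i ≤ (2 : ℝ) ^ (-((ρ - 2 * τ) * n))) :
    (((Finset.univ.powersetCard l).filter fun S : Finset (Fin n) =>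
      (2 : ℝ) ^ (-((ρ - 3 * τ) * l)) < ∏ i ∈ S, y i).card : ℝ) ≤
      n.choose l * Real.exp (-(l * nu τ ^ 2 / 2)) := by
  have hL := one_le_logb_inv h0 h1
  have hl2 : 0 < Real.log 2 := Real.log_pos one_lt_two
  set Λ := Real.log (1 / τ) with hΛ
  have hΛ' : Real.logb 2 (1 / τ) = Λ / Real.log 2 := rfl
  have hΛ0 : 0 < Λ := by
    rw [hΛ', le_div_iff₀ hl2] at hL; linarith
  have hnu : nu τ = τ * Real.log 2 / Λ := by
    rw [nu, hΛ']; field_simp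
  -- This s minimizes the Chernoff exponent -sτ log 2 + s²Λ²/2 per sample; the minimum is -ν²/2.
  set s := τ * Real.log 2 / Λ ^ 2 with hs
  have hs0 : 0 < s := by positivity
  have hy0 : ∀ i, 0 < y i := fun i => h0.trans_le (hy i)
  have hu0 : ∀ i, 0 ≤ -Real.log (y i) := fun i => by
    have := Real.log_nonpos (hy0 i).le (hy1 i); linarith
  have hu1 : ∀ i, -Real.log (y i) ≤ Λ := fun i => by
    rw [hΛ, one_div, Real.log_inv]
    have := Real.log_le_log h0 (hy i); linarith
  have hyp : ∀ i, y i ^ s ≤ 1 - s * (-Real.log (y i)) + s ^ 2 * Λ ^ 2 / 2 := by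
    intro i
    have e : y i ^ s = Real.exp (-(s * (-Real.log (y i)))) := by
      rw [Real.rpow_def_of_pos (hy0 i)]; congr 1; ring
    rw [e]
    refine (exp_neg_le_quadratic (mul_nonneg hs0.le (hu0 i))).trans ?_
    have := pow_le_pow_left₀ (hu0 i) (hu1 i) 2
    have := mul_le_mul_of_nonneg_left this (sq_nonneg s)
    rw [mul_pow]; linarith
  have hnR : (0 : ℝ) < n := by exact_mod_cast hn
  have hmean : (∑ i, y i ^ s) / n ≤
      Real.exp (-(s * ((ρ - 2 * τ) * Real.log 2)) + s ^ 2 * Λ ^ 2 / 2) := by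
    have h3 : ∑ i, y i ^ s ≤ n * (1 + s ^ 2 * Λ ^ 2 / 2) + s * Real.log (∏ i, y i) := by
      refine (Finset.sum_le_sum fun i _ => hyp i).trans (le_of_eq ?_)
      rw [Real.log_prod (fun i _ => (hy0 i).ne'), Finset.sum_add_distrib, Finset.sum_sub_distrib,
        ← Finset.mul_sum, Finset.sum_neg_distrib]
      simp only [Finset.sum_const, Finset.card_univ, Fintype.card_fin, nsmul_eq_mul]
      ring
    have h4 : Real.log (∏ i, y i) ≤ -((ρ - 2 * τ) * n) * Real.log 2 := by
      have := Real.log_le_log (Finset.prod_pos fun i _ => hy0 i) hprod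
      rwa [Real.log_rpow two_pos] at this
    have h5 := mul_le_mul_of_nonneg_left h4 hs0.le
    rw [div_le_iff₀ hnR]
    have h6 := Real.add_one_le_exp (-(s * ((ρ - 2 * τ) * Real.log 2)) + s ^ 2 * Λ ^ 2 / 2)
    have h7 := mul_le_mul_of_nonneg_right h6 hnR.le
    refine le_trans ?_ h7
    linarith
  -- Maclaurin's inequality replaces independence: the mean over S of ∏ y^s is at most the l-th
  -- power of the mean of y^s.
  have hmac := sum_powersetCard_prod_le (Finset.univ : Finset (Fin n)) (fun i => y i ^ s)
    (fun i => (Real.rpow_nonneg (hy0 i).le s)) l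
  simp only [Finset.card_univ, Fintype.card_fin] at hmac
  have hK : ∀ S ∈ (Finset.univ.powersetCard l).filter (fun S : Finset (Fin n) =>
      (2 : ℝ) ^ (-((ρ - 3 * τ) * l)) < ∏ i ∈ S, y i),
      1 ≤ Real.exp (s * ((ρ - 3 * τ) * l * Real.log 2)) * ∏ i ∈ S, y i ^ s := by
    intro S hS
    have hS := (Finset.mem_filter.1 hS).2
    rw [Real.finsetProd_rpow _ _ (fun i _ => (hy0 i).le)]
    have h := Real.rpow_le_rpow (by positivity) hS.le hs0.le
    refine le_trans (le_of_eq ?_) (mul_le_mul_of_nonneg_left h (Real.exp_pos _).le)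
    rw [← Real.rpow_mul two_pos.le, two_rpow_eq_exp, ← Real.exp_add]
    rw [show s * ((ρ - 3 * τ) * l * Real.log 2) + Real.log 2 * (-((ρ - 3 * τ) * l) * s) = 0 by ring,
      Real.exp_zero]
  have hm0 : 0 ≤ (∑ i, y i ^ s) / n :=
    div_nonneg (Finset.sum_nonneg fun i _ => Real.rpow_nonneg (hy0 i).le s) hnR.le
  rw [Finset.card_eq_sum_ones, Nat.cast_sum, Nat.cast_one]
  calc _ ≤ ∑ S ∈ (Finset.univ.powersetCard l).filter (fun S : Finset (Fin n) =>
      (2 : ℝ) ^ (-((ρ - 3 * τ) * l)) < ∏ i ∈ S, y i),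
        Real.exp (s * ((ρ - 3 * τ) * l * Real.log 2)) * ∏ i ∈ S, y i ^ s := Finset.sum_le_sum hK
    _ ≤ ∑ S ∈ Finset.univ.powersetCard l,
        Real.exp (s * ((ρ - 3 * τ) * l * Real.log 2)) * ∏ i ∈ S, y i ^ s :=
      Finset.sum_le_sum_of_subset_of_nonneg (Finset.filter_subset _ _) fun S _ _ =>
        mul_nonneg (Real.exp_pos _).le
          (Finset.prod_nonneg fun i _ => Real.rpow_nonneg (hy0 i).le s)
    _ ≤ Real.exp (s * ((ρ - 3 * τ) * l * Real.log 2)) * (n.choose l *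
        Real.exp (-(s * ((ρ - 2 * τ) * Real.log 2)) + s ^ 2 * Λ ^ 2 / 2) ^ l) := by
      rw [← Finset.mul_sum]
      refine mul_le_mul_of_nonneg_left (hmac.trans ?_) (Real.exp_pos _).le
      exact mul_le_mul_of_nonneg_left (pow_le_pow_left₀ hm0 hmean l) (Nat.cast_nonneg _)
    _ = _ := by
      rw [← Real.exp_nat_mul, mul_left_comm, ← Real.exp_add]
      congr 2
      rw [hnu, hs]
      field_simp
      ring

/-- Min-entropy sampling: for most position sets `S` of size `l`, the string restricted to `S`
keeps the min-entropy rate up to `3 τ`, outside of an event of small probability. -/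
theorem sum_not_spread_le (hQ : ∀ x, 0 ≤ Q x) (hQ1 : ∑ x, Q x = 1) {τ ρ : ℝ} (h0 : 0 < τ)
    (h1 : τ < 1 / 3) (hmin : ∀ x, Q x ≤ (2 : ℝ) ^ (-(ρ * n))) {l : ℕ} (hn : 0 < n)
    (hln : 4 * l ≤ n) :
    ∑ S ∈ Finset.univ.powersetCard l, ∑ x with x ∉ spread Q ((2 : ℝ) ^ (-((ρ - 3 * τ) * l))) S, Q x ≤
      n.choose l * (2 * Real.exp (-(l * nu τ ^ 2 / 2))) := by
  set K := (2 : ℝ) ^ (-((ρ - 3 * τ) * l)) with hK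
  set D := Real.exp (-(l * nu τ ^ 2 / 2)) with hD
  have hp : ∀ x (S : Finset (Fin n)), x ∉ spread Q K S → K < ∏ i ∈ S, max (chainProb Q i x) τ := by
    intro x S hx
    have : K < ∏ i ∈ S, chainProb Q i x := by simpa [spread] using hx
    exact this.trans_le (Finset.prod_le_prod (fun i _ => chainProb_nonneg hQ i x)
      fun i _ => le_max_left _ _)
  have key : ∀ x, Q x * (((Finset.univ.powersetCard l).filter fun S => x ∉ spread Q K S).card : ℝ) ≤
      n.choose l * ((if (2 : ℝ) ^ (-((ρ - 2 * τ) * n)) < ∏ i, max (chainProb Q i x) τ then Q x else 0) +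
        Q x * D) := by
    intro x
    -- An atypical x is charged with every S; for any other x only the heavy S count, which are a
    -- fraction D of all.
    split_ifs with hx
    · have h2 : (((Finset.univ.powersetCard l).filter fun S => x ∉ spread Q K S).card : ℝ) ≤
          n.choose l := by
        have := Finset.card_filter_le (Finset.univ.powersetCard l) fun S => x ∉ spread Q K S
        rw [Finset.card_powersetCard, Finset.card_univ, Fintype.card_fin] at this
        exact_mod_cast this
      have h3 := mul_le_mul_of_nonneg_left h2 (hQ x)
      have h4 : 0 ≤ (n.choose l : ℝ) * (Q x * D) :=
        mul_nonneg (Nat.cast_nonneg _) (mul_nonneg (hQ x) (Real.exp_pos _).le)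
      linarith
    · rw [zero_add, mul_left_comm]
      refine mul_le_mul_of_nonneg_left ?_ (hQ x)
      refine le_trans ?_ (card_heavy_subsets_le h0 h1 hn l (fun i => max (chainProb Q i x) τ)
        (fun i => le_max_right _ _) (fun i => max_le (chainProb_le_one hQ i x) (by linarith))
        (not_lt.1 hx))
      exact_mod_cast Finset.card_le_card fun S hS => by
        obtain ⟨hS1, hS2⟩ := Finset.mem_filter.1 hS
        exact Finset.mem_filter.2 ⟨hS1, hp x S hS2⟩
  calc _ = ∑ x, Q x * (((Finset.univ.powersetCard l).filter fun S => x ∉ spread Q K S).card : ℝ) := by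
        simp only [Finset.sum_filter]
        rw [Finset.sum_comm]
        refine Finset.sum_congr rfl fun x _ => ?_
        rw [← Finset.sum_filter, Finset.sum_const, nsmul_eq_mul, mul_comm]
    _ ≤ ∑ x, n.choose l * ((if (2 : ℝ) ^ (-((ρ - 2 * τ) * n)) < ∏ i, max (chainProb Q i x) τ
          then Q x else 0) + Q x * D) := Finset.sum_le_sum fun x _ => key x
    _ ≤ n.choose l * (2 * D) := by
        rw [← Finset.mul_sum, Finset.sum_add_distrib, ← Finset.sum_mul, hQ1, ← Finset.sum_filter]
        have := sum_atypical_le hQ h0 h1 hmin hln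
        refine mul_le_mul_of_nonneg_left ?_ (Nat.cast_nonneg _)
        linarith

/-! ### Subsets of Alice's positions. -/

noncomputable section

/-- The positions in `Fin n` of a subset `C` of the positions of `A`. -/
def composeSubset {n k l : ℕ} (A : Subset n k) (C : Subset k l) : Finset (Fin n) :=
  C.1.map (A.1.orderEmbOfFin A.2).toEmbedding

theorem card_supersets {n k l : ℕ} (S : Finset (Fin n)) (hS : S.card = l) (hlk : l ≤ k) :
    ((Finset.univ.powersetCard k).filter fun A : Finset (Fin n) => S ⊆ A).card =
      (n - l).choose (k - l) := by
  have hc : Sᶜ.card = n - l := by rw [Finset.card_compl, Fintype.card_fin, hS]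
  rw [← hc, ← Finset.card_powersetCard]
  refine Finset.card_bij' (fun A _ => A \ S) (fun B _ => B ∪ S) ?_ ?_ ?_ ?_
  · intro A hA
    obtain ⟨hA1, hA2⟩ := Finset.mem_filter.1 hA
    rw [Finset.mem_powersetCard]
    refine ⟨fun i hi => Finset.mem_compl.2 (Finset.mem_sdiff.1 hi).2, ?_⟩
    rw [Finset.card_sdiff_of_subset hA2, (Finset.mem_powersetCard.1 hA1).2, hS]
  · intro B hB
    obtain ⟨hB1, hB2⟩ := Finset.mem_powersetCard.1 hB
    have hd : Disjoint B S := Finset.disjoint_left.2 fun i hi => Finset.mem_compl.1 (hB1 hi)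
    refine Finset.mem_filter.2 ⟨Finset.mem_powersetCard.2 ⟨Finset.subset_univ _, ?_⟩,
      Finset.subset_union_right⟩
    rw [Finset.card_union_of_disjoint hd, hB2, hS]
    omega
  · intro A hA
    exact Finset.sdiff_union_of_subset (Finset.mem_filter.1 hA).2
  · intro B hB
    have hB1 := (Finset.mem_powersetCard.1 hB).1
    have hd : Disjoint B S := Finset.disjoint_left.2 fun i hi => Finset.mem_compl.1 (hB1 hi)
    exact Finset.union_sdiff_cancel_right hd

/-- Each S arises once from every A that contains it, and each S has the same number of supersets A.
Hence a uniform subset of a uniform A is a uniform subset of all positions. -/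
theorem sum_composeSubset {n k l : ℕ} (hlk : l ≤ k) (f : Finset (Fin n) → ℝ) :
    ∑ A : Subset n k, ∑ C : Subset k l, f (composeSubset A C) =
      (n - l).choose (k - l) * ∑ S ∈ Finset.univ.powersetCard l, f S := by
  have h1 : ∀ A : Subset n k, ∑ C : Subset k l, f (composeSubset A C) =
      ∑ S ∈ A.1.powersetCard l, f S := by
    intro A
    conv_rhs => rw [← Finset.map_orderEmbOfFin_univ A.1 A.2, Finset.powersetCard_map,
      Finset.sum_map]
    exact (Finset.sum_subtype (Finset.univ.powersetCard l)
      (p := fun C : Finset (Fin k) => C.card = l)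
      (fun C => by simp [Finset.mem_powersetCard])
      (fun C => f (C.map (A.1.orderEmbOfFin A.2).toEmbedding))).symm
  rw [Finset.sum_congr rfl fun A _ => h1 A]
  rw [← Finset.sum_subtype (Finset.univ.powersetCard k) (p := fun A : Finset (Fin n) => A.card = k)
    (fun A => by simp [Finset.mem_powersetCard]) (fun A => ∑ S ∈ A.powersetCard l, f S)]
  have h2 : ∀ A : Finset (Fin n), ∑ S ∈ A.powersetCard l, f S =
      ∑ S ∈ Finset.univ.powersetCard l, if S ⊆ A then f S else 0 := by
    intro A
    rw [← Finset.sum_filter]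
    refine Finset.sum_congr ?_ fun _ _ => rfl
    ext S
    simp [Finset.mem_powersetCard, and_comm]
  rw [Finset.sum_congr rfl fun A _ => h2 A, Finset.sum_comm, Finset.mul_sum]
  refine Finset.sum_congr rfl fun S hS => ?_
  rw [← Finset.sum_filter, Finset.sum_const, card_supersets S (Finset.mem_powersetCard.1 hS).2 hlk,
    nsmul_eq_mul]

variable {n k l : ℕ} {Q : Bits n → ℝ}

/-- If some x₀ restricts to z, agreement with z means agreement with x₀ on `composeSubset A C`, so
`sum_spread_le` applies; otherwise the sum is empty. -/
theorem sum_spread_restrict_le (hQ : ∀ x, 0 ≤ Q x) (hQ1 : ∑ x, Q x = 1) {K : ℝ} (hK : 0 ≤ K)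
    (A : Subset n k) (C : Subset k l) (z : Bits l) :
    ∑ x ∈ spread Q K (composeSubset A C) with restrict (restrict x A) C = z, Q x ≤ K := by
  by_cases h : ∃ x₀ : Bits n, restrict (restrict x₀ A) C = z
  · obtain ⟨x₀, rfl⟩ := h
    refine le_trans ?_ (sum_spread_le hQ hQ1 hK (composeSubset A C) x₀)
    refine Finset.sum_le_sum_of_subset_of_nonneg ?_ fun x _ _ => hQ x
    intro x hx
    obtain ⟨hx1, hx2⟩ := Finset.mem_filter.1 hx
    refine Finset.mem_filter.2 ⟨hx1, fun i hi => ?_⟩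
    obtain ⟨j, hj, rfl⟩ := Finset.mem_map.1 hi
    rw [← Finset.map_orderEmbOfFin_univ C.1 C.2] at hj
    obtain ⟨u, -, rfl⟩ := Finset.mem_map.1 hj
    exact congrFun hx2 u
  · rw [Finset.filter_false_of_mem fun x _ hx => h ⟨x, hx⟩, Finset.sum_empty]
    exact hK

theorem sum_not_spread_compose_le (hQ : ∀ x, 0 ≤ Q x) (hQ1 : ∑ x, Q x = 1) {τ ρ : ℝ} (h0 : 0 < τ)
    (h1 : τ < 1 / 3) (hmin : ∀ x, Q x ≤ (2 : ℝ) ^ (-(ρ * n))) (hn : 0 < n)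
    (hln : 4 * l ≤ n) (hlk : l ≤ k) :
    ∑ A : Subset n k, ∑ C : Subset k l,
        ∑ x with x ∉ spread Q ((2 : ℝ) ^ (-((ρ - 3 * τ) * l))) (composeSubset A C), Q x ≤
      n.choose k * k.choose l * (2 * Real.exp (-(l * nu τ ^ 2 / 2))) := by
  rw [sum_composeSubset hlk fun S => ∑ x with x ∉ spread Q ((2 : ℝ) ^ (-((ρ - 3 * τ) * l))) S, Q x]
  have h := sum_not_spread_le hQ hQ1 h0 h1 hmin hn hln
  refine (mul_le_mul_of_nonneg_left h (Nat.cast_nonneg _)).trans (le_of_eq ?_)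
  rw [← mul_assoc]
  congr 1
  have := Nat.choose_mul (n := n) hlk
  rw [mul_comm]
  exact_mod_cast this.symm

/-! ### Probabilities of events. -/

section Prob

variable {Ω Ω' : Type}

theorem toOuterMeasure_le_one (P : PMF Ω) (E : Set Ω) : P.toOuterMeasure E ≤ 1 := by
  rw [PMF.toOuterMeasure_apply, ← P.tsum_coe]
  exact ENNReal.tsum_le_tsum fun x => Set.indicator_le_self' (fun _ _ => zero_le) x

theorem toOuterMeasure_ne_top (P : PMF Ω) (E : Set Ω) : P.toOuterMeasure E ≠ ⊤ :=
  ((toOuterMeasure_le_one P E).trans_lt ENNReal.one_lt_top).ne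

theorem prob_nonneg (P : PMF Ω) (E : Set Ω) : 0 ≤ prob P E := ENNReal.toReal_nonneg

theorem prob_le_one (P : PMF Ω) (E : Set Ω) : prob P E ≤ 1 :=
  ENNReal.toReal_le_of_le_ofReal zero_le_one (by simpa using toOuterMeasure_le_one P E)

theorem abs_prob_sub_le_one (P Q : PMF Ω) (E : Set Ω) : |prob P E - prob Q E| ≤ 1 := by
  rw [abs_le]
  constructor <;> linarith [prob_nonneg P E, prob_le_one P E, prob_nonneg Q E, prob_le_one Q E]

theorem abs_prob_sub_le_statDist (P Q : PMF Ω) (E : Set Ω) :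
    |prob P E - prob Q E| ≤ statDist P Q :=
  le_ciSup (f := fun E => |prob P E - prob Q E|)
    ⟨1, by rintro _ ⟨E, rfl⟩; exact abs_prob_sub_le_one P Q E⟩ E

theorem statDist_le {P Q : PMF Ω} {d : ℝ} (h1 : ∀ E, prob P E ≤ prob Q E + d)
    (h2 : ∀ E, prob Q E ≤ prob P E + d) : statDist P Q ≤ d :=
  ciSup_le fun E => abs_le.2 ⟨by linarith [h2 E], by linarith [h1 E]⟩

theorem prob_map (P : PMF Ω) (f : Ω → Ω') (E : Set Ω') : prob (P.map f) E = prob P (f ⁻¹' E) := by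
  rw [prob, PMF.toOuterMeasure_map_apply]; rfl

theorem prob_bind_fintype [Fintype Ω] (P : PMF Ω) (f : Ω → PMF Ω') (E : Set Ω') :
    prob (P.bind f) E = ∑ x, (P x).toReal * prob (f x) E := by
  rw [prob, PMF.toOuterMeasure_bind_apply, tsum_fintype, ENNReal.toReal_sum]
  · simp only [ENNReal.toReal_mul]; rfl
  · exact fun x _ => ENNReal.mul_ne_top (P.apply_ne_top x) (toOuterMeasure_ne_top _ _)

theorem sum_toReal_eq_one [Fintype Ω] (P : PMF Ω) : ∑ x, (P x).toReal = 1 := by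
  rw [← ENNReal.toReal_sum fun x _ => P.apply_ne_top x, ← tsum_fintype (L := .unconditional _),
    P.tsum_coe, ENNReal.toReal_one]

theorem prob_uniform_bind [Fintype Ω] [Nonempty Ω] (f : Ω → PMF Ω') (E : Set Ω') :
    prob ((PMF.uniformOfFintype Ω).bind f) E = (∑ x, prob (f x) E) / Fintype.card Ω := by
  rw [prob_bind_fintype, Finset.sum_div]
  refine Finset.sum_congr rfl fun x _ => ?_
  rw [PMF.uniformOfFintype_apply, ENNReal.toReal_inv, ENNReal.toReal_natCast]
  ring

end Prob

/-! ### Encryption with extracted keys. -/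

theorem bxor_bxor {n : ℕ} (a b : Bits n) : bxor a (bxor a b) = b := by
  funext j; simp [bxor]

theorem bxor_involutive {n : ℕ} (a : Bits n) : Function.Involutive (bxor a) := bxor_bxor a

variable {l r q p : ℕ} (extract : Bits l → Bits r → Bits q × Bits p)

/-- The probability over the seed that the encrypted secret `s ⊕ Y`, the seed and the helper
string, computed from the string `z`, have a given property. -/
def cipherProb (E : Set (Bits q × Bits r × Bits p)) (s : Bits q) (z : Bits l) : ℝ :=
  prob (PMF.uniformOfFintype (Bits r))
    {R | (bxor s (extract z R).1, R, (extract z R).2) ∈ E}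

theorem cipherProb_nonneg (E : Set (Bits q × Bits r × Bits p)) (s : Bits q) (z : Bits l) :
    0 ≤ cipherProb extract E s z := prob_nonneg _ _

theorem cipherProb_le_one (E : Set (Bits q × Bits r × Bits p)) (s : Bits q) (z : Bits l) :
    cipherProb extract E s z ≤ 1 := prob_le_one _ _

theorem prob_extractLaw (X : PMF (Bits l)) (E : Set (Bits q × Bits r × Bits p)) (s : Bits q) :
    prob (extractLaw extract X) {v | (bxor s v.1, v.2) ∈ E} =
      ∑ z, (X z).toReal * cipherProb extract E s z := by
  rw [extractLaw, prob_bind_fintype]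
  refine Finset.sum_congr rfl fun z _ => ?_
  rw [prob_map]; rfl

/-- With an ideal key the encrypted secret carries no information. -/
theorem prob_idealLaw_bxor (X : PMF (Bits l)) (E : Set (Bits q × Bits r × Bits p))
    (s s' : Bits q) :
    prob (idealLaw extract X) {v | (bxor s v.1, v.2) ∈ E} =
      prob (idealLaw extract X) {v | (bxor s' v.1, v.2) ∈ E} := by
  have h : ∀ s, prob (idealLaw extract X) {v | (bxor s v.1, v.2) ∈ E} =
      (∑ u, prob (extractLaw extract X) {v | (u, v.2) ∈ E}) / Fintype.card (Bits q) := by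
    intro s
    rw [idealLaw, prob_uniform_bind, ← Equiv.sum_comp (bxor_involutive s).toPerm
      fun u => prob (extractLaw extract X) {v | (u, v.2) ∈ E}]
    congr 1
    refine Finset.sum_congr rfl fun u _ => ?_
    rw [prob_map]; rfl
  rw [h, h]

theorem le_minEntropy {X : PMF (Bits l)} {κ : ℝ} (h : ∀ z, (X z).toReal ≤ (2 : ℝ) ^ (-κ)) :
    κ ≤ minEntropy X := by
  have hsup : ⨆ z, (X z).toReal ≤ (2 : ℝ) ^ (-κ) := ciSup_le h
  obtain ⟨z, hz⟩ := X.support_nonempty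
  have hpos : 0 < ⨆ z, (X z).toReal :=
    (ENNReal.toReal_pos ((PMF.mem_support_iff _ _).1 hz) (X.apply_ne_top z)).trans_le
      (le_ciSup (Set.finite_range fun z => (X z).toReal).bddAbove z)
  have := Real.logb_le_logb_of_le one_lt_two hpos hsup
  rw [Real.logb_rpow two_pos (by norm_num)] at this
  rw [minEntropy]
  linarith

theorem apply_le_of_le_minEntropy {X : PMF (Bits l)} {κ : ℝ} (h : κ ≤ minEntropy X) (z : Bits l) :
    (X z).toReal ≤ (2 : ℝ) ^ (-κ) := by
  have hle : (X z).toReal ≤ ⨆ z, (X z).toReal :=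
    le_ciSup (Set.finite_range fun z => (X z).toReal).bddAbove z
  rcases (ENNReal.toReal_nonneg (a := X z)).eq_or_lt with h0 | h0
  · rw [← h0]; positivity
  · refine hle.trans ?_
    rw [minEntropy] at h
    rw [← Real.logb_le_iff_le_rpow one_lt_two (h0.trans_le hle)]
    linarith

variable {extract} {κ ε : ℝ}

/-- Normalizing σ gives a κ-source. Both secrets are compared with the ideal key, where they are
indistinguishable, and each comparison costs |ε|. The unnormalized form can be summed over the
values of a leak. -/
theorem sum_cipherProb_le
    (hsec : ∀ X : PMF (Bits l), κ ≤ minEntropy X →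
      statDist (extractLaw extract X) (idealLaw extract X) ≤ ε)
    (σ : Bits l → ℝ) (hσ : ∀ z, 0 ≤ σ z) (hmax : ∀ z, σ z ≤ (2 : ℝ) ^ (-κ) * ∑ z, σ z)
    (E : Set (Bits q × Bits r × Bits p)) (s s' : Bits q) :
    ∑ z, σ z * cipherProb extract E s z ≤
      ∑ z, σ z * cipherProb extract E s' z + 2 * |ε| * ∑ z, σ z := by
  set m := ∑ z, σ z with hm
  have hm0 : 0 ≤ m := Finset.sum_nonneg fun z _ => hσ z
  rcases hm0.eq_or_lt with h0 | h0
  · have hz : ∀ z, σ z = 0 := fun z =>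
      (Finset.sum_eq_zero_iff_of_nonneg fun z _ => hσ z).1 (hm ▸ h0.symm) z (Finset.mem_univ z)
    simp [hz, ← h0]
  · have hsum : ∑ z, ENNReal.ofReal (σ z / m) = 1 := by
      rw [← ENNReal.ofReal_sum_of_nonneg fun z _ => div_nonneg (hσ z) hm0, ← Finset.sum_div, ← hm,
        div_self h0.ne', ENNReal.ofReal_one]
    set X : PMF (Bits l) := PMF.ofFintype (fun z => ENNReal.ofReal (σ z / m)) hsum with hX
    have hXz : ∀ z, (X z).toReal = σ z / m := fun z => by
      rw [hX, PMF.ofFintype_apply, ENNReal.toReal_ofReal (div_nonneg (hσ z) hm0)]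
    have hent : κ ≤ minEntropy X := le_minEntropy fun z => by
      rw [hXz, div_le_iff₀ h0]; exact hmax z
    have hd := hsec X hent
    have h1 := (abs_le.1 ((abs_prob_sub_le_statDist (extractLaw extract X) (idealLaw extract X)
      {v | (bxor s v.1, v.2) ∈ E}).trans (hd.trans (le_abs_self ε)))).2
    have h2 := (abs_le.1 ((abs_prob_sub_le_statDist (extractLaw extract X) (idealLaw extract X)
      {v | (bxor s' v.1, v.2) ∈ E}).trans (hd.trans (le_abs_self ε)))).1
    rw [prob_idealLaw_bxor extract X E s s'] at h1
    rw [prob_extractLaw] at h1 h2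
    have h3 : ∑ z, (X z).toReal * cipherProb extract E s z ≤
        ∑ z, (X z).toReal * cipherProb extract E s' z + 2 * |ε| := by linarith
    have e : ∀ s, m * ∑ z, (X z).toReal * cipherProb extract E s z =
        ∑ z, σ z * cipherProb extract E s z := by
      intro s
      rw [Finset.mul_sum]
      refine Finset.sum_congr rfl fun z _ => ?_
      rw [hXz]; field_simp
    have h4 := mul_le_mul_of_nonneg_left h3 hm0
    rw [mul_add, e, e] at h4
    linarith

/-- A spread string yields good keys even if a leak with few values is known. -/
theorem sum_cipherProb_leak_le
    (hsec : ∀ X : PMF (Bits l), κ ≤ minEntropy X →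
      statDist (extractLaw extract X) (idealLaw extract X) ≤ ε)
    {Ω Λ : Type} [Fintype Ω] [DecidableEq Ω] [Fintype Λ] [DecidableEq Λ]
    (Q : Ω → ℝ) (hQ : ∀ x, 0 ≤ Q x) (G : Finset Ω) (f : Ω → Bits l) {K : ℝ} (hK0 : 0 ≤ K)
    (hK : ∀ z, ∑ x ∈ G with f x = z, Q x ≤ K) (leak : Ω → Λ)
    (E : Λ → Set (Bits q × Bits r × Bits p)) (s s' : Bits q) :
    ∑ x, Q x * cipherProb extract (E (leak x)) s (f x) ≤
      ∑ x, Q x * cipherProb extract (E (leak x)) s' (f x) + ∑ x with x ∉ G, Q x +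
        Fintype.card Λ * (K * (2 : ℝ) ^ κ) + 2 * |ε| * ∑ x, Q x := by
  set σ : Λ → Bits l → ℝ := fun lam z => ∑ x ∈ G with leak x = lam ∧ f x = z, Q x with hσ
  have hσ0 : ∀ lam z, 0 ≤ σ lam z := fun lam z => Finset.sum_nonneg fun x _ => hQ x
  have hσK : ∀ lam z, σ lam z ≤ K := fun lam z => by
    refine le_trans (Finset.sum_le_sum_of_subset_of_nonneg ?_ fun x _ _ => hQ x) (hK z)
    intro x hx
    obtain ⟨h1, h2⟩ := Finset.mem_filter.1 hx
    exact Finset.mem_filter.2 ⟨h1, h2.2⟩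
  have hgroup : ∀ φ : Λ → Bits l → ℝ,
      ∑ x ∈ G, Q x * φ (leak x) (f x) = ∑ lam, ∑ z, σ lam z * φ lam z := by
    intro φ
    rw [← Finset.sum_fiberwise_of_maps_to (t := Finset.univ) (g := leak) fun _ _ => Finset.mem_univ _]
    refine Finset.sum_congr rfl fun lam _ => ?_
    rw [← Finset.sum_fiberwise_of_maps_to (t := Finset.univ) (g := f) fun _ _ => Finset.mem_univ _]
    refine Finset.sum_congr rfl fun z _ => ?_
    rw [Finset.filter_filter, hσ, Finset.sum_mul]
    refine Finset.sum_congr rfl fun x hx => ?_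
    obtain ⟨-, h1, h2⟩ := Finset.mem_filter.1 hx
    rw [h1, h2]
  have hper : ∀ lam, ∑ z, σ lam z * cipherProb extract (E lam) s z ≤
      ∑ z, σ lam z * cipherProb extract (E lam) s' z + K * (2 : ℝ) ^ κ +
        2 * |ε| * ∑ z, σ lam z := by
    intro lam
    have hK2 : 0 ≤ K * (2 : ℝ) ^ κ := by positivity
    -- A leak value of mass at least K·2^κ still leaves a κ-source, since no z has mass above K. A
    -- lighter value is given up entirely, at a cost of at most K·2^κ.
    by_cases hheavy : K ≤ (2 : ℝ) ^ (-κ) * ∑ z, σ lam z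
    · have := sum_cipherProb_le hsec (σ lam) (hσ0 lam) (fun z => (hσK lam z).trans hheavy) (E lam) s s'
      linarith
    · have h1 : ∑ z, σ lam z ≤ K * (2 : ℝ) ^ κ := by
        have h2 := mul_le_mul_of_nonneg_right (not_le.1 hheavy).le
          (Real.rpow_nonneg two_pos.le κ)
        rw [mul_right_comm, ← Real.rpow_add two_pos, neg_add_cancel, Real.rpow_zero, one_mul] at h2
        exact h2
      have h2 : ∑ z, σ lam z * cipherProb extract (E lam) s z ≤ ∑ z, σ lam z :=
        Finset.sum_le_sum fun z _ => mul_le_of_le_one_right (hσ0 lam z) (cipherProb_le_one _ _ _ _)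
      have h3 : 0 ≤ ∑ z, σ lam z * cipherProb extract (E lam) s' z :=
        Finset.sum_nonneg fun z _ => mul_nonneg (hσ0 lam z) (cipherProb_nonneg _ _ _ _)
      have h4 : 0 ≤ 2 * |ε| * ∑ z, σ lam z :=
        mul_nonneg (by positivity) (Finset.sum_nonneg fun z _ => hσ0 lam z)
      linarith
  have hmass : ∑ lam, ∑ z, σ lam z = ∑ x ∈ G, Q x := by
    have := hgroup fun _ _ => 1
    simpa using this.symm
  have hG : ∑ x ∈ G, Q x * cipherProb extract (E (leak x)) s (f x) ≤
      ∑ x ∈ G, Q x * cipherProb extract (E (leak x)) s' (f x) +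
        Fintype.card Λ * (K * (2 : ℝ) ^ κ) + 2 * |ε| * ∑ x ∈ G, Q x := by
    rw [hgroup fun lam z => cipherProb extract (E lam) s z,
      hgroup fun lam z => cipherProb extract (E lam) s' z, ← hmass]
    refine (Finset.sum_le_sum fun lam _ => hper lam).trans (le_of_eq ?_)
    rw [Finset.sum_add_distrib, Finset.sum_add_distrib, Finset.sum_const, Finset.card_univ,
      nsmul_eq_mul, Finset.mul_sum Finset.univ (fun lam => ∑ z, σ lam z)]
  have hsplit : ∀ φ : Ω → ℝ, ∑ x, φ x = ∑ x ∈ G, φ x + ∑ x with x ∉ G, φ x := by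
    intro φ
    rw [← Finset.sum_filter_add_sum_filter_not Finset.univ (· ∈ G)]
    simp
  have hnG : ∑ x with x ∉ G, Q x * cipherProb extract (E (leak x)) s (f x) ≤
      ∑ x with x ∉ G, Q x * cipherProb extract (E (leak x)) s' (f x) + ∑ x with x ∉ G, Q x := by
    rw [← Finset.sum_add_distrib]
    refine Finset.sum_le_sum fun x _ => ?_
    have h1 := mul_le_of_le_one_right (hQ x) (cipherProb_le_one extract (E (leak x)) s (f x))
    have h2 := mul_nonneg (hQ x) (cipherProb_nonneg extract (E (leak x)) s' (f x))
    linarith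
  have h5 : 2 * |ε| * ∑ x ∈ G, Q x ≤ 2 * |ε| * ∑ x, Q x :=
    mul_le_mul_of_nonneg_left (Finset.sum_le_sum_of_subset_of_nonneg (Finset.subset_univ _)
      fun x _ _ => hQ x) (by positivity)
  rw [hsplit fun x => Q x * cipherProb extract (E (leak x)) s (f x),
    hsplit fun x => Q x * cipherProb extract (E (leak x)) s' (f x)]
  linarith

/-! ### One run of the transfer stage -/

/-- The function on `Bool` with value `a` at `g` and `b` at `!g`. -/
def boolPair {α : Type} (g : Bool) (a b : α) : Bool → α := fun j => if j = g then a else b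

theorem prob_uniform_boolFun {α : Type} [Fintype α] [DecidableEq α] [Nonempty α] (g : Bool)
    (E : Set (Bool → α)) :
    prob (PMF.uniformOfFintype (Bool → α)) E =
      (∑ b, prob (PMF.uniformOfFintype α) {a | boolPair g a b ∈ E}) / Fintype.card α := by
  have h : PMF.uniformOfFintype (Bool → α) = (PMF.uniformOfFintype α).bind fun b =>
      (PMF.uniformOfFintype α).map fun a => boolPair g a b := by
    ext R
    simp only [PMF.bind_apply, PMF.map_apply, PMF.uniformOfFintype_apply, tsum_fintype]
    rw [Finset.sum_eq_single (R !g), Finset.sum_eq_single (R g), if_pos]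
    · rw [Fintype.card_fun, Fintype.card_bool, pow_two, Nat.cast_mul, ENNReal.mul_inv]
      · simp
      · simp
    · funext j
      cases g <;> cases j <;> simp [boolPair]
    · intro a _ ha
      rw [if_neg]
      intro h
      have := congrFun h g
      simp only [boolPair, if_true] at this
      exact ha this.symm
    · simp
    · intro b _ hb
      rw [Finset.sum_eq_zero, mul_zero]
      intro a _
      rw [if_neg]
      rintro rfl
      simp [boolPair] at hb
    · simp
  rw [h, prob_uniform_bind]
  simp only [prob_map]
  rfl

namespace OTProtocol

variable {l : ℕ} {P : OTProtocol l} {γ : ℝ}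

/-- For a fixed seed b at `!g`, the key and helper string from `C (!g)` form a leak with 2^(q + p)
values, so `C false` and `C true` need not be disjoint. The secret encrypted at `!g` is common to
`s` and `s'` and is absorbed into the event `Ev`. -/
theorem sum_transfer_le {κ ε : ℝ}
    (hsec : ∀ X : PMF (Bits l), κ ≤ minEntropy X →
      statDist (extractLaw P.extract X) (idealLaw P.extract X) ≤ ε)
    (B : P.BobStrategy γ) (c : Bool) (v : SetupView B) {e : Bool} {C : Bool → Subset P.k l}
    (he : B.reply c v.coins v.memory v.positions v.messages v.W = some e)
    (hC : ∀ j, P.decode (v.W j) = some (C j)) (g : Bool)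
    (Q : Bits P.n → ℝ) (hQ : ∀ x, 0 ≤ Q x) (G : Finset (Bits P.n)) {K : ℝ} (hK0 : 0 ≤ K)
    (hK : ∀ z, ∑ x ∈ G with restrict (restrict x v.positions) (C g) = z, Q x ≤ K)
    (s s' : Bool → Bits P.q) (hs : s (!(xor g e)) = s' (!(xor g e)))
    (E : Set (SetupView B × P.TransferMessage)) :
    ∑ x, Q x * prob (PMF.uniformOfFintype (Bool → Bits P.r))
        {R | (v, aliceTransfer B c x R s v) ∈ E} ≤
      ∑ x, Q x * prob (PMF.uniformOfFintype (Bool → Bits P.r))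
        {R | (v, aliceTransfer B c x R s' v) ∈ E} + ∑ x with x ∉ G, Q x +
        2 ^ (P.q + P.p) * (K * (2 : ℝ) ^ κ) + 2 * |ε| * ∑ x, Q x := by
  set f : Bool → Bits P.n → Bits l := fun j x => restrict (restrict x v.positions) (C j) with hf
  have htr : ∀ (x : Bits P.n) (R : Bool → Bits P.r) (s : Bool → Bits P.q),
      aliceTransfer B c x R s v = some fun j =>
        (bxor (s (xor j e)) (P.extract (f j x) (R j)).1, R j, (P.extract (f j x) (R j)).2) := by
    intro x R s
    simp only [aliceTransfer, he, hC, hf]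
    congr 1
    funext j
    cases j <;> simp
  set Ev : Bits P.r → Bits P.q × Bits P.p → Set (Bits P.q × Bits P.r × Bits P.p) := fun b lam =>
    {t | (v, some (boolPair g t (bxor (s (!(xor g e))) lam.1, b, lam.2))) ∈ E} with hEv
  have hev : ∀ (s₁ : Bool → Bits P.q), s₁ (!(xor g e)) = s (!(xor g e)) → ∀ x b,
      prob (PMF.uniformOfFintype (Bits P.r))
        {a | boolPair g a b ∈ {R | (v, aliceTransfer B c x R s₁ v) ∈ E}} =
      cipherProb P.extract (Ev b (P.extract (f (!g) x) b)) (s₁ (xor g e)) (f g x) := by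
    intro s₁ hs₁ x b
    unfold cipherProb
    congr 1
    ext a
    simp only [Set.mem_ofPred_eq, hEv, htr]
    rw [← hs₁]
    have : (fun j => (bxor (s₁ (xor j e)) (P.extract (f j x) (boolPair g a b j)).1,
        boolPair g a b j, (P.extract (f j x) (boolPair g a b j)).2)) =
        boolPair g (bxor (s₁ (xor g e)) (P.extract (f g x) a).1, a, (P.extract (f g x) a).2)
          (bxor (s₁ (!(xor g e))) (P.extract (f (!g) x) b).1, b, (P.extract (f (!g) x) b).2) := by
      funext j
      cases g <;> cases j <;> simp [boolPair]
    rw [this]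
  have hsplit : ∀ (s₁ : Bool → Bits P.q), s₁ (!(xor g e)) = s (!(xor g e)) →
      ∑ x, Q x * prob (PMF.uniformOfFintype (Bool → Bits P.r))
        {R | (v, aliceTransfer B c x R s₁ v) ∈ E} =
      (∑ b, ∑ x, Q x * cipherProb P.extract (Ev b (P.extract (f (!g) x) b)) (s₁ (xor g e)) (f g x)) /
        Fintype.card (Bits P.r) := by
    intro s₁ hs₁
    rw [Finset.sum_comm, Finset.sum_div]
    refine Finset.sum_congr rfl fun x _ => ?_
    rw [prob_uniform_boolFun g, ← Finset.mul_sum, mul_div_assoc]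
    congr 2
    exact Finset.sum_congr rfl fun b _ => hev s₁ hs₁ x b
  rw [hsplit s rfl, hsplit s' hs.symm]
  have hcard : (0 : ℝ) < Fintype.card (Bits P.r) := by exact_mod_cast Fintype.card_pos
  have hb : ∀ b, _ := fun b => sum_cipherProb_leak_le hsec Q hQ G (f g) hK0 hK
    (fun x => P.extract (f (!g) x) b) (Ev b) (s (xor g e)) (s' (xor g e))
  have hsum := Finset.sum_le_sum fun b (_ : b ∈ Finset.univ) => hb b
  have hL : (Fintype.card (Bits P.q × Bits P.p) : ℝ) = 2 ^ (P.q + P.p) := by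
    simp [pow_add]
  rw [hL] at hsum
  simp only [Finset.sum_add_distrib, Finset.sum_const, Finset.card_univ, nsmul_eq_mul] at hsum
  rw [div_le_iff₀ hcard]
  refine hsum.trans (le_of_eq ?_)
  field_simp

end OTProtocol

/-! ### Conditioning on the stored string -/

section Fiber

variable {α β μ : Type} [Fintype β] [DecidableEq μ]

/-- The mass of the pairs with first component `x` for which the string `w` is stored. -/
def fiberMass (source : PMF (α × β)) (M : β → μ) (w : μ) (x : α) : ℝ :=
  ∑ y, if M y = w then (source (x, y)).toReal else 0

variable (source : PMF (α × β)) (M : β → μ)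

theorem fiberMass_nonneg (w : μ) (x : α) : 0 ≤ fiberMass source M w x :=
  Finset.sum_nonneg fun y _ => by split_ifs <;> simp

theorem fiberMass_le [Fintype α] (w : μ) (x : α) :
    fiberMass source M w x ≤ ((source.map Prod.fst) x).toReal := by
  classical
  have h : ((source.map Prod.fst) x).toReal = ∑ y, (source (x, y)).toReal := by
    rw [PMF.map_apply, tsum_fintype, Fintype.sum_prod_type, Finset.sum_eq_single x]
    · simp only [if_true]
      exact ENNReal.toReal_sum fun y _ => source.apply_ne_top _
    · intro x' _ hx'
      exact Finset.sum_eq_zero fun y _ => if_neg fun h => hx' h.symm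
    · simp
  rw [h]
  refine Finset.sum_le_sum fun y _ => ?_
  split_ifs <;> simp

/-- Averages over the source are grouped by the stored string. No assumption on the correlation
between the two components is needed. -/
theorem sum_source_eq_sum_fiberMass [Fintype α] (φ : μ → α → ℝ) :
    ∑ x, (source x).toReal * φ (M x.2) x.1 =
      ∑ w ∈ Finset.univ.image M, ∑ x, fiberMass source M w x * φ w x := by
  rw [Fintype.sum_prod_type, Finset.sum_comm' (t' := Finset.univ) (s' := fun _ => Finset.univ.image M)
    (by simp)]
  refine Finset.sum_congr rfl fun x _ => ?_
  simp only [fiberMass, Finset.sum_mul]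
  rw [Finset.sum_comm]
  refine Finset.sum_congr rfl fun y _ => ?_
  rw [Finset.sum_eq_single (M y)]
  · simp
  · intro w _ hw
    rw [if_neg (Ne.symm hw), zero_mul]
  · intro h
    exact absurd (Finset.mem_image_of_mem M (Finset.mem_univ y)) h

end Fiber

/-- All lengths up to N are allowed, hence the exponent N + 1. This is the origin of the summand 1
in `rho`. -/
theorem card_bitlists_le (N : ℕ) (t : Finset (List Bool)) (ht : ∀ w ∈ t, w.length ≤ N) :
    t.card ≤ 2 ^ (N + 1) := by
  have hsub : t ⊆ (Finset.range (N + 1)).biUnion fun j =>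
      (Finset.univ : Finset (Fin j → Bool)).image List.ofFn := by
    intro w hw
    rw [Finset.mem_biUnion]
    exact ⟨w.length, Finset.mem_range.2 (Nat.lt_succ_of_le (ht w hw)),
      Finset.mem_image.2 ⟨w.get, Finset.mem_univ _, List.ofFn_get w⟩⟩
  refine (Finset.card_le_card hsub).trans (Finset.card_biUnion_le.trans ?_)
  calc _ ≤ ∑ j ∈ Finset.range (N + 1), 2 ^ j := Finset.sum_le_sum fun j _ => by
        refine Finset.card_image_le.trans ?_
        simp
    _ ≤ 2 ^ (N + 1) := by
        have := Nat.geomSum_eq (m := 2) le_rfl (N + 1)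
        rw [this]
        simp

theorem card_memories_le {a : ℝ} (t : Finset {w : List Bool // (w.length : ℝ) ≤ a}) (ha : 0 ≤ a) :
    (t.card : ℝ) ≤ 2 ^ (a + 1) := by
  have h := card_bitlists_le ⌊a⌋₊ (t.map (Function.Embedding.subtype _)) fun w hw => by
    obtain ⟨⟨w, hw'⟩, -, rfl⟩ := Finset.mem_map.1 hw
    exact Nat.le_floor hw'
  rw [Finset.card_map] at h
  calc (t.card : ℝ) ≤ ((2 ^ (⌊a⌋₊ + 1) : ℕ) : ℝ) := by exact_mod_cast h
    _ = (2 : ℝ) ^ ((⌊a⌋₊ : ℝ) + 1) := by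
        rw [Nat.cast_pow, Nat.cast_ofNat, ← Real.rpow_natCast]; push_cast; rfl
    _ ≤ 2 ^ (a + 1) := Real.rpow_le_rpow_of_exponent_le one_le_two
        (by linarith [Nat.floor_le ha])

/-! ### Averaging errors over arbitrary laws. -/

theorem toOuterMeasure_bind_le {Ω Ω' : Type} (P : PMF Ω) (f g : Ω → PMF Ω') (E : Set Ω')
    (d : Ω → ENNReal) (h : ∀ a, (f a).toOuterMeasure E ≤ (g a).toOuterMeasure E + d a) :
    (P.bind f).toOuterMeasure E ≤ (P.bind g).toOuterMeasure E + ∑' a, P a * d a := by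
  rw [PMF.toOuterMeasure_bind_apply, PMF.toOuterMeasure_bind_apply, ← ENNReal.tsum_add]
  refine ENNReal.tsum_le_tsum fun a => ?_
  rw [← mul_add]
  exact mul_le_mul_right (h a) _

theorem toOuterMeasure_le_of_prob_le {Ω : Type} {P Q : PMF Ω} {E : Set Ω} {d : ℝ}
    (h : prob P E ≤ prob Q E + d) :
    P.toOuterMeasure E ≤ Q.toOuterMeasure E + ENNReal.ofReal d := by
  rw [← ENNReal.ofReal_toReal (toOuterMeasure_ne_top P E),
    ← ENNReal.ofReal_toReal (toOuterMeasure_ne_top Q E)]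
  exact (ENNReal.ofReal_le_ofReal h).trans ENNReal.ofReal_add_le

theorem prob_le_of_toOuterMeasure_le {Ω : Type} {P Q : PMF Ω} {E : Set Ω} {d : ℝ} (hd : 0 ≤ d)
    (h : P.toOuterMeasure E ≤ Q.toOuterMeasure E + ENNReal.ofReal d) :
    prob P E ≤ prob Q E + d := by
  have := ENNReal.toReal_mono
    (ENNReal.add_ne_top.2 ⟨toOuterMeasure_ne_top Q E, ENNReal.ofReal_ne_top⟩) h
  rwa [ENNReal.toReal_add (toOuterMeasure_ne_top Q E) ENNReal.ofReal_ne_top,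
    ENNReal.toReal_ofReal hd] at this

/-- Averaging a bound with an error constant except on a finite family of events. -/
theorem prob_bind_le_of_events {Ω Ω' ι : Type} [Fintype ι] (P : PMF Ω) (f g : Ω → PMF Ω')
    (E : Set Ω') (d : ℝ) (hd : 0 ≤ d) (w : ι → ℝ) (hw : ∀ i, 0 ≤ w i) (F : ι → Set Ω)
    (h : ∀ a, prob (f a) E ≤ prob (g a) E + (d + ∑ i, w i * (F i).indicator 1 a)) :
    prob (P.bind f) E ≤ prob (P.bind g) E + (d + ∑ i, w i * prob P (F i)) := by
  have h0 : ∀ i, 0 ≤ w i * prob P (F i) := fun i => mul_nonneg (hw i) (prob_nonneg _ _)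
  refine prob_le_of_toOuterMeasure_le (add_nonneg hd (Finset.sum_nonneg fun i _ => h0 i)) ?_
  refine (toOuterMeasure_bind_le P f g E _ fun a => toOuterMeasure_le_of_prob_le (h a)).trans
    (add_le_add_right (le_of_eq ?_) _)
  have h1 : ∀ i a, 0 ≤ w i * (F i).indicator (1 : Ω → ℝ) a := fun i a =>
    mul_nonneg (hw i) (Set.indicator_nonneg (fun _ _ => zero_le_one) _)
  have h2 : ∀ a, P a * ENNReal.ofReal (d + ∑ i, w i * (F i).indicator 1 a) =
      P a * ENNReal.ofReal d + ∑ i, ENNReal.ofReal (w i) * (F i).indicator P a := by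
    intro a
    rw [ENNReal.ofReal_add hd (Finset.sum_nonneg fun i _ => h1 i a),
      ENNReal.ofReal_sum_of_nonneg fun i _ => h1 i a, mul_add, Finset.mul_sum]
    congr 1
    refine Finset.sum_congr rfl fun i _ => ?_
    by_cases ha : a ∈ F i
    · simp [ha, mul_comm]
    · simp [ha]
  simp only [h2]
  rw [ENNReal.tsum_add, ENNReal.tsum_mul_right, P.tsum_coe, one_mul,
    ENNReal.ofReal_add hd (Finset.sum_nonneg fun i _ => h0 i),
    ENNReal.ofReal_sum_of_nonneg fun i _ => h0 i]
  congr 1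
  rw [Summable.tsum_finsetSum fun _ _ => ENNReal.summable]
  refine Finset.sum_congr rfl fun i _ => ?_
  rw [ENNReal.tsum_mul_left, ENNReal.ofReal_mul (hw i), prob,
    ENNReal.ofReal_toReal (toOuterMeasure_ne_top _ _), PMF.toOuterMeasure_apply]

/-! ### Bad subsets and their encodings. -/

namespace OTProtocol

theorem decode_eq_some {l : ℕ} {P : OTProtocol l} {W : Bits P.m} {C : Subset P.k l}
    (h : P.decode W = some C) : ∃ j, P.encode (C, j) = W := by
  obtain ⟨⟨C', j⟩, h1, h2⟩ := Option.map_eq_some_iff.1 h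
  obtain rfl : C' = C := h2
  exact ⟨j, (P.encode_injective.isPartialInv _ _).1 h1⟩

variable {l : ℕ} {P : OTProtocol l} {γ : ℝ}

section Setup

variable (B : P.BobStrategy γ) (c : Bool) (source : PMF (Bits P.n × Bits P.n)) (K η : ℝ)

/-- The probability that Bob stores `w`, given his coins. -/
def memoryMass (ω : B.Coins) (w : P.Memory γ) : ℝ := ∑ x, fiberMass source (B.store c ω) w x

/-- The law of Alice's source given Bob's coins and stored string. -/
def condSource (ω : B.Coins) (w : P.Memory γ) (x : Bits P.n) : ℝ :=
  fiberMass source (B.store c ω) w x / memoryMass B c source ω w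

/-- The subsets of Alice's positions on which the source is too predictable for Bob. -/
def badSubsets (ω : B.Coins) (w : P.Memory γ) (A : Subset P.n P.k) : Finset (Subset P.k l) :=
  {C | η < ∑ x with x ∉ spread (condSource B c source ω w) K (composeSubset A C),
    condSource B c source ω w x}

open Classical in
/-- The encodings of the bad subsets. -/
def badStrings (ω : B.Coins) (w : P.Memory γ) (A : Subset P.n P.k) : Finset (Bits P.m) :=
  {W | ∃ C ∈ badSubsets B c source K η ω w A, P.decode W = some C}

/-- The index of a subset which is not bad, if there is one. -/
def keyIndex (v : SetupView B) : Bool :=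
  open Classical in
  decide (v.W false ∈ badStrings B c source K η v.coins v.memory v.positions)

/-- The index of the secret that Bob may learn. -/
def knownIndex (v : SetupView B) : Bool :=
  !(xor (keyIndex B c source K η v)
    ((B.reply c v.coins v.memory v.positions v.messages v.W).getD false))

variable {B c source K η}

theorem memoryMass_nonneg (ω : B.Coins) (w : P.Memory γ) : 0 ≤ memoryMass B c source ω w :=
  Finset.sum_nonneg fun x _ => fiberMass_nonneg _ _ w x

theorem condSource_nonneg (ω : B.Coins) (w : P.Memory γ) (x : Bits P.n) :
    0 ≤ condSource B c source ω w x :=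
  div_nonneg (fiberMass_nonneg _ _ w x) (memoryMass_nonneg ω w)

theorem sum_condSource {ω : B.Coins} {w : P.Memory γ} (h : 0 < memoryMass B c source ω w) :
    ∑ x, condSource B c source ω w x = 1 := by
  unfold condSource
  rw [← Finset.sum_div]
  exact div_self h.ne'

theorem fiberMass_eq_mul {ω : B.Coins} {w : P.Memory γ} (h : 0 < memoryMass B c source ω w)
    (x : Bits P.n) : fiberMass source (B.store c ω) w x =
      memoryMass B c source ω w * condSource B c source ω w x := by
  rw [condSource, mul_div_cancel₀ _ h.ne']

/-- The joint probability of x and w is at most 2^(-αn), and w has probability at least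
ε'·2^(-(γn+1)); the quotient of these bounds is exactly 2^(-ρn). -/
theorem condSource_le {α ε' : ℝ} (hε' : 0 < ε') (hn : 0 < P.n)
    (hmin : α * P.n ≤ minEntropy (source.map Prod.fst)) {ω : B.Coins} {w : P.Memory γ}
    (hw : ε' ≤ memoryMass B c source ω w * 2 ^ (γ * P.n + 1)) (x : Bits P.n) :
    condSource B c source ω w x ≤ 2 ^ (-(rho α γ ε' P.n * P.n)) := by
  have h2 : (0 : ℝ) < 2 ^ (γ * P.n + 1) := by positivity
  have hm : 0 < memoryMass B c source ω w := by
    by_contra h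
    have := mul_nonpos_of_nonpos_of_nonneg (not_lt.1 h) h2.le
    linarith
  have hn' : (P.n : ℝ) ≠ 0 := Nat.cast_ne_zero.2 hn.ne'
  have e : -(rho α γ ε' P.n * P.n) = -(α * P.n) + (γ * P.n + 1) + Real.logb 2 (1 / ε') := by
    rw [rho]; field_simp; ring
  rw [e, Real.rpow_add two_pos, Real.rpow_add two_pos,
    Real.rpow_logb two_pos (by norm_num) (by positivity), condSource, div_le_iff₀ hm]
  have h3 := (fiberMass_le source (B.store c ω) w x).trans (apply_le_of_le_minEntropy hmin x)
  refine h3.trans ?_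
  have h4 : (2 : ℝ) ^ (-(α * P.n)) * 2 ^ (γ * P.n + 1) * (1 / ε') * memoryMass B c source ω w =
      2 ^ (-(α * P.n)) * (memoryMass B c source ω w * 2 ^ (γ * P.n + 1) / ε') := by ring
  rw [h4]
  exact le_mul_of_one_le_right (by positivity) ((one_le_div hε').2 hw)

/-- Every subset has the same number of encodings, at most 2^m / binom(k, l), so bad strings are no
denser than bad subsets. -/
theorem card_badStrings_le (ω : B.Coins) (w : P.Memory γ) (A : Subset P.n P.k) :
    ((badStrings B c source K η ω w A).card : ℝ) ≤
      (badSubsets B c source K η ω w A).card * (2 ^ P.m / P.k.choose l) := by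
  classical
  have hsub : badStrings B c source K η ω w A ⊆
      (badSubsets B c source K η ω w A ×ˢ Finset.univ).image P.encode := by
    intro W hW
    obtain ⟨C, hC, hd⟩ := (Finset.mem_filter.1 hW).2
    obtain ⟨j, hj⟩ := decode_eq_some hd
    exact Finset.mem_image.2 ⟨(C, j), Finset.mem_product.2 ⟨hC, Finset.mem_univ _⟩, hj⟩
  have h := (Finset.card_le_card hsub).trans Finset.card_image_le
  rw [Finset.card_product, Finset.card_univ, Fintype.card_fin] at h
  calc ((badStrings B c source K η ω w A).card : ℝ) ≤
      ((badSubsets B c source K η ω w A).card * (2 ^ P.m / P.k.choose l) : ℕ) := by exact_mod_cast h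
    _ ≤ _ := by
      rw [Nat.cast_mul]
      refine mul_le_mul_of_nonneg_left ?_ (Nat.cast_nonneg _)
      exact (Nat.cast_div_le).trans (by push_cast; exact le_rfl)

/-- By Markov's inequality, for most of Alice's positions few subsets are bad. -/
theorem card_many_badSubsets_le {τ ρ β : ℝ} (h0 : 0 < τ) (h1 : τ < 1 / 3) (hn : 0 < P.n)
    (hln : 4 * l ≤ P.n) (hlk : l ≤ P.k) (hη : 0 < η) (hβ : 0 < β) {ω : B.Coins}
    {w : P.Memory γ} (hm : 0 < memoryMass B c source ω w)
    (hmin : ∀ x, condSource B c source ω w x ≤ 2 ^ (-(ρ * P.n)))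
    (hK : K = 2 ^ (-((ρ - 3 * τ) * l))) :
    (((Finset.univ : Finset (Subset P.n P.k)).filter fun A =>
      β * P.k.choose l < (badSubsets B c source K η ω w A).card).card : ℝ) ≤
      P.n.choose P.k * (2 * Real.exp (-(l * nu τ ^ 2 / 2)) / (β * η)) := by
  have hc := condSource_nonneg (B := B) (c := c) (source := source) ω w
  have hsamp := sum_not_spread_compose_le (k := P.k) hc (sum_condSource hm) h0 h1 hmin hn hln hlk
  rw [← hK] at hsamp
  set D := Real.exp (-(l * nu τ ^ 2 / 2)) with hD
  have hck : (0 : ℝ) < P.k.choose l := by exact_mod_cast Nat.choose_pos hlk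
  -- Markov's inequality over C for fixed A, with threshold η; the bound `hsum` below is the one
  -- over A, with threshold β·binom(k, l).
  have hA : ∀ A : Subset P.n P.k, (badSubsets B c source K η ω w A).card * η ≤
      ∑ C : Subset P.k l, ∑ x with x ∉ spread (condSource B c source ω w) K (composeSubset A C),
        condSource B c source ω w x := by
    intro A
    rw [← nsmul_eq_mul, ← Finset.sum_const]
    refine (Finset.sum_le_sum fun C hC => (Finset.mem_filter.1 hC).2.le).trans ?_
    exact Finset.sum_le_sum_of_subset_of_nonneg (Finset.subset_univ _) fun C _ _ =>
      Finset.sum_nonneg fun x _ => hc x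
  set S := (Finset.univ : Finset (Subset P.n P.k)).filter fun A =>
      β * P.k.choose l < (badSubsets B c source K η ω w A).card with hS
  have hsum : (S.card : ℝ) * (β * P.k.choose l * η) ≤
      P.n.choose P.k * P.k.choose l * (2 * D) := by
    refine le_trans ?_ hsamp
    rw [← nsmul_eq_mul, ← Finset.sum_const]
    refine (Finset.sum_le_sum fun A hA' => (mul_le_mul_of_nonneg_right
      (Finset.mem_filter.1 hA').2.le hη.le).trans (hA A)).trans ?_
    exact Finset.sum_le_sum_of_subset_of_nonneg (Finset.subset_univ _) fun A _ _ =>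
      Finset.sum_nonneg fun C _ => Finset.sum_nonneg fun x _ => hc x
  rw [← mul_div_assoc, le_div_iff₀ (mul_pos hβ hη)]
  refine le_of_mul_le_mul_right ?_ hck
  calc _ = (S.card : ℝ) * (β * P.k.choose l * η) := by ring
    _ ≤ _ := hsum
    _ = _ := by ring

/-- Unless both strings encode bad subsets, Bob's view hardly depends on the secret whose index
is not `knownIndex`. -/
theorem sum_fiber_transfer_le {κ ε L : ℝ}
    (hsec : ∀ X : PMF (Bits l), κ ≤ minEntropy X →
      statDist (extractLaw P.extract X) (idealLaw P.extract X) ≤ ε)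
    (hK : 0 ≤ K) (hη : 0 ≤ η) (hL : 2 ^ (P.q + P.p) * (K * (2 : ℝ) ^ κ) ≤ L) (v : SetupView B)
    (hm : 0 < memoryMass B c source v.coins v.memory)
    (hW : ¬ ∀ j, v.W j ∈ badStrings B c source K η v.coins v.memory v.positions)
    (s s' : Bool → Bits P.q)
    (hs : s (knownIndex B c source K η v) = s' (knownIndex B c source K η v))
    (E : Set (SetupView B × P.TransferMessage)) :
    ∑ x, fiberMass source (B.store c v.coins) v.memory x *
        prob (PMF.uniformOfFintype (Bool → Bits P.r)) {R | (v, aliceTransfer B c x R s v) ∈ E} ≤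
      ∑ x, fiberMass source (B.store c v.coins) v.memory x *
        prob (PMF.uniformOfFintype (Bool → Bits P.r)) {R | (v, aliceTransfer B c x R s' v) ∈ E} +
        (η + L + 2 * |ε|) * memoryMass B c source v.coins v.memory := by
  set m := memoryMass B c source v.coins v.memory with hmdef
  have hL0 : 0 ≤ L := le_trans (by positivity) hL
  have hextra : 0 ≤ (η + L + 2 * |ε|) * m :=
    mul_nonneg (add_nonneg (add_nonneg hη hL0) (by positivity)) hm.le
  by_cases hok : ∃ e C₀ C₁, B.reply c v.coins v.memory v.positions v.messages v.W = some e ∧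
      P.decode (v.W false) = some C₀ ∧ P.decode (v.W true) = some C₁
  · obtain ⟨e, C₀, C₁, he, hC₀, hC₁⟩ := hok
    set C : Bool → Subset P.k l := fun j => if j then C₁ else C₀ with hC
    have hCd : ∀ j, P.decode (v.W j) = some (C j) := by
      intro j; cases j <;> simp [hC, hC₀, hC₁]
    set g := keyIndex B c source K η v with hg
    -- `keyIndex` avoids `W false` exactly if that string is bad, and then `hW` makes `W true` good.
    have hgood : C g ∉ badSubsets B c source K η v.coins v.memory v.positions := by
      intro hbad
      have hmem : v.W g ∈ badStrings B c source K η v.coins v.memory v.positions :=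
        Finset.mem_filter.2 ⟨Finset.mem_univ _, C g, hbad, hCd g⟩
      rcases hgv : g with _ | _
      · have : ¬ v.W false ∈ badStrings B c source K η v.coins v.memory v.positions := by
          rw [hg, keyIndex] at hgv
          exact of_decide_eq_false hgv
        rw [hgv] at hmem
        exact this hmem
      · have h1 : v.W false ∈ badStrings B c source K η v.coins v.memory v.positions := by
          rw [hg, keyIndex] at hgv
          exact of_decide_eq_true hgv
        rw [hgv] at hmem
        exact hW fun j => by cases j <;> assumption
    have hgood' : ∑ x with x ∉ spread (condSource B c source v.coins v.memory) K
        (composeSubset v.positions (C g)), condSource B c source v.coins v.memory x ≤ η := by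
      by_contra h
      exact hgood (Finset.mem_filter.2 ⟨Finset.mem_univ _, not_le.1 h⟩)
    have hki : knownIndex B c source K η v = !(xor g e) := by
      rw [knownIndex, he, Option.getD_some]
    rw [hki] at hs
    have hmul := fiberMass_eq_mul hm
    have h := sum_transfer_le hsec B c v he hCd g (fiberMass source (B.store c v.coins) v.memory)
      (fiberMass_nonneg _ _ _) (spread (condSource B c source v.coins v.memory) K
        (composeSubset v.positions (C g))) (K := m * K) (mul_nonneg hm.le hK)
      (fun z => by
        simp only [hmul]
        rw [← Finset.mul_sum]
        exact mul_le_mul_of_nonneg_left (sum_spread_restrict_le (condSource_nonneg _ _)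
          (sum_condSource hm) hK _ _ z) hm.le) s s' hs E
    have h1 : ∑ x with x ∉ spread (condSource B c source v.coins v.memory) K
        (composeSubset v.positions (C g)), fiberMass source (B.store c v.coins) v.memory x ≤
        m * η := by
      simp only [hmul]
      rw [← Finset.mul_sum]
      exact mul_le_mul_of_nonneg_left hgood' hm.le
    have h2 := mul_le_mul_of_nonneg_left hL hm.le
    have h3 : ∑ x, fiberMass source (B.store c v.coins) v.memory x = m := rfl
    rw [h3] at h
    have h4 : 2 ^ (P.q + P.p) * (m * K * (2 : ℝ) ^ κ) =
      m * (2 ^ (P.q + P.p) * (K * (2 : ℝ) ^ κ)) := by ring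
    linarith
  -- Bob's abort or an invalid encoding: Alice's message is `none`, whatever the secrets.
  · have hnone : ∀ x R s₁, aliceTransfer B c x R s₁ v = none := by
      intro x R s₁
      unfold aliceTransfer
      split
      · rename_i e C₀ C₁ he h0 h1
        exact absurd ⟨e, C₀, C₁, he, h0, h1⟩ hok
      · rfl
    simp only [hnone]
    linarith

end Setup

end OTProtocol

/-! ### Bob's whole view. -/

theorem prob_mono {Ω : Type} (P : PMF Ω) {E F : Set Ω} (h : E ⊆ F) : prob P E ≤ prob P F :=
  ENNReal.toReal_mono (toOuterMeasure_ne_top P F) (P.toOuterMeasure.mono h)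

namespace OTProtocol

variable {l : ℕ} {P : OTProtocol l} {γ : ℝ}

/-- Bob's setup view as a function of all coins and of his stored string. -/
def setupView (B : P.BobStrategy γ) (c : Bool) (ω : B.Coins) (A : Subset P.n P.k)
    (a : P.hashing.CoinsA) (w : P.Memory γ) : SetupView B :=
  ⟨ω, w, A, P.hashing.run (P.hashing.alice a) (B.hash c ω w A),
    P.hashing.outA a (P.hashing.run (P.hashing.alice a) (B.hash c ω w A))⟩

/-- The law of Bob's view for fixed coins and positions. -/
def viewOfCoins (B : P.BobStrategy γ) (c : Bool) (source : PMF (Bits P.n × Bits P.n))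
    (s : SetupView B → Bool → Bits P.q) (ω : B.Coins) (A : Subset P.n P.k)
    (a : P.hashing.CoinsA) : PMF (SetupView B × P.TransferMessage) :=
  source.bind fun x => (PMF.uniformOfFintype (Bool → Bits P.r)).map fun R =>
    (setupView B c ω A a (B.store c ω x.2),
      aliceTransfer B c x.1 R (s (setupView B c ω A a (B.store c ω x.2)))
        (setupView B c ω A a (B.store c ω x.2)))

/-- The source is independent of all coins and of A, so it may be drawn after them. For fixed coins
and positions the setup view is then a function of the stored string. -/
theorem view_eq (B : P.BobStrategy γ) (c : Bool) (source : PMF (Bits P.n × Bits P.n))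
    (s : SetupView B → Bool → Bits P.q) :
    view B c source s = B.coins.bind fun ω => (uniformSubset P.k_le).bind fun A =>
      P.hashing.coinsA.bind fun a => viewOfCoins B c source s ω A a := by
  unfold view
  rw [PMF.bind_comm]
  congr 1; funext ω
  rw [PMF.bind_comm]
  congr 1; funext A
  rw [PMF.bind_comm]
  rfl

section

variable (B : P.BobStrategy γ) (c : Bool) (source : PMF (Bits P.n × Bits P.n)) (K η ε' β : ℝ)

/-- The stored string is too unlikely, or too many subsets of Alice's positions are bad. -/
def Exceptional (ω : B.Coins) (A : Subset P.n P.k) (w : P.Memory γ) : Prop :=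
  memoryMass B c source ω w * 2 ^ (γ * P.n + 1) < ε' ∨
    β * P.k.choose l < (badSubsets B c source K η ω w A).card

/-- Alice's coins for which both outputs of interactive hashing encode bad subsets. -/
def bothBad (ω : B.Coins) (A : Subset P.n P.k) (w : P.Memory γ) : Set P.hashing.CoinsA :=
  {a | ¬ Exceptional B c source K η ε' β ω A w ∧
    ∀ j, (setupView B c ω A a w).W j ∈ badStrings B c source K η ω w A}

variable {B c source K η ε' β}

/-- For fixed ω, A and w the set of bad strings is fixed before hashing. Outside the exceptional
case it has at most β·2^m elements, so the binding property applies to the deterministic strategy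
`B.hash c ω w A`. -/
theorem prob_bothBad_le {t θ : ℝ}
    (hbind : ∀ T : Finset (Bits P.m), (T.card : ℝ) ≤ (2 : ℝ) ^ t → ∀ B : PMF P.hashing.PlayB,
      prob (P.hashing.lawB B) {V | V false ∈ T ∧ V true ∈ T} ≤ θ)
    (hlk : l ≤ P.k) (ht : β * 2 ^ P.m ≤ (2 : ℝ) ^ t)
    (ω : B.Coins) (A : Subset P.n P.k) (w : P.Memory γ) :
    prob P.hashing.coinsA (bothBad B c source K η ε' β ω A w) ≤ |θ| := by
  by_cases hex : Exceptional B c source K η ε' β ω A w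
  · have : bothBad B c source K η ε' β ω A w = ∅ := by
      ext a; simp [bothBad, hex]
    rw [this]
    simp [prob]
  · have hcard : ((badStrings B c source K η ω w A).card : ℝ) ≤ (2 : ℝ) ^ t := by
      refine (card_badStrings_le ω w A).trans (le_trans ?_ ht)
      have h1 := not_lt.1 fun h => hex (Or.inr h)
      have hck : (0 : ℝ) < P.k.choose l := by exact_mod_cast Nat.choose_pos hlk
      refine (mul_le_mul_of_nonneg_right h1 (by positivity)).trans (le_of_eq ?_)
      field_simp
    have h2 := hbind _ hcard (PMF.pure (B.hash c ω w A))
    have h3 : P.hashing.lawB (PMF.pure (B.hash c ω w A)) =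
        P.hashing.coinsA.map fun a => (setupView B c ω A a w).W := by
      unfold HashingProtocol.lawB
      simp only [PMF.pure_map]
      rfl
    rw [h3, prob_map] at h2
    refine le_trans (prob_mono _ ?_) (h2.trans (le_abs_self θ))
    intro a ha
    exact ⟨ha.2 false, ha.2 true⟩

open Classical in
-- The error is computed separately for each stored string. The event `bothBad` is kept as an
-- indicator in a, because the binding property bounds it only after averaging over Alice's coins.
theorem prob_viewOfCoins_le {κ ε L : ℝ}
    (hsec : ∀ X : PMF (Bits l), κ ≤ minEntropy X →
      statDist (extractLaw P.extract X) (idealLaw P.extract X) ≤ ε)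
    (hε' : 0 < ε') (hK : 0 ≤ K) (hη : 0 ≤ η) (hL : 2 ^ (P.q + P.p) * (K * (2 : ℝ) ^ κ) ≤ L)
    (s s' : SetupView B → Bool → Bits P.q)
    (hs : ∀ v, s v (knownIndex B c source K η v) = s' v (knownIndex B c source K η v))
    (E : Set (SetupView B × P.TransferMessage)) (ω : B.Coins) (A : Subset P.n P.k)
    (a : P.hashing.CoinsA) :
    prob (viewOfCoins B c source s ω A a) E ≤ prob (viewOfCoins B c source s' ω A a) E +
      ((η + L + 2 * |ε| + ∑ x, (source x).toReal *
          if Exceptional B c source K η ε' β ω A (B.store c ω x.2) then 1 else 0) +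
        ∑ x, (source x).toReal *
          (bothBad B c source K η ε' β ω A (B.store c ω x.2)).indicator 1 a) := by
  set φ : (SetupView B → Bool → Bits P.q) → P.Memory γ → Bits P.n → ℝ := fun s w x =>
    prob (PMF.uniformOfFintype (Bool → Bits P.r)) {R | (setupView B c ω A a w,
      aliceTransfer B c x R (s (setupView B c ω A a w)) (setupView B c ω A a w)) ∈ E} with hφ
  have hprob : ∀ s, prob (viewOfCoins B c source s ω A a) E =
      ∑ x, (source x).toReal * φ s (B.store c ω x.2) x.1 := by
    intro s
    rw [viewOfCoins, prob_bind_fintype]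
    refine Finset.sum_congr rfl fun x _ => ?_
    rw [prob_map]; rfl
  set C := η + L + 2 * |ε| with hC
  have hL0 : 0 ≤ L := le_trans (by positivity) hL
  have hC0 : 0 ≤ C := add_nonneg (add_nonneg hη hL0) (by positivity)
  set ψ : P.Memory γ → ℝ := fun w => C +
    (if Exceptional B c source K η ε' β ω A w then 1 else 0) +
      (bothBad B c source K η ε' β ω A w).indicator 1 a with hψ
  have hq := fun w => fiberMass_nonneg source (B.store c ω) w
  have hφ0 : ∀ s w x, 0 ≤ φ s w x := fun s w x => prob_nonneg _ _
  have hφ1 : ∀ s w x, φ s w x ≤ 1 := fun s w x => prob_le_one _ _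
  have hper : ∀ w, ∑ x, fiberMass source (B.store c ω) w x * φ s w x ≤
      ∑ x, fiberMass source (B.store c ω) w x * (φ s' w x + ψ w) := by
    intro w
    -- An exceptional w, or coins a in `bothBad`, are charged the trivial error 1.
    have htriv : 1 ≤ ψ w → ∑ x, fiberMass source (B.store c ω) w x * φ s w x ≤
        ∑ x, fiberMass source (B.store c ω) w x * (φ s' w x + ψ w) := fun h =>
      Finset.sum_le_sum fun x _ => mul_le_mul_of_nonneg_left
        (by linarith [hφ1 s w x, hφ0 s' w x]) (hq w x)
    by_cases hex : Exceptional B c source K η ε' β ω A w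
    · refine htriv ?_
      have : 0 ≤ (bothBad B c source K η ε' β ω A w).indicator (1 : P.hashing.CoinsA → ℝ) a :=
        Set.indicator_nonneg (fun _ _ => zero_le_one) _
      simp only [hψ, if_pos hex]
      linarith
    by_cases hbb : a ∈ bothBad B c source K η ε' β ω A w
    · refine htriv ?_
      simp only [hψ, if_neg hex, Set.indicator_of_mem hbb, Pi.one_apply]
      linarith
    have hψw : ψ w = C := by
      simp only [hψ, if_neg hex, Set.indicator_of_notMem hbb, add_zero]
    have hm : 0 < memoryMass B c source ω w := by
      by_contra h
      refine hex (Or.inl (lt_of_le_of_lt ?_ hε'))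
      exact mul_nonpos_of_nonpos_of_nonneg (not_lt.1 h) (by positivity)
    have h := sum_fiber_transfer_le hsec hK hη hL (setupView B c ω A a w) hm
      (fun hW => hbb ⟨hex, hW⟩) (s (setupView B c ω A a w)) (s' (setupView B c ω A a w)) (hs _) E
    refine h.trans (le_of_eq ?_)
    simp only [hψw, mul_add, Finset.sum_add_distrib]
    rw [← Finset.sum_mul (f := fun x => fiberMass source (B.store c ω) w x) (a := C)]
    simp only [hC, memoryMass, hφ]
    congr 1
    simp only [setupView]
    ring
  rw [hprob, hprob, sum_source_eq_sum_fiberMass source (B.store c ω) (φ s)]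
  refine (Finset.sum_le_sum fun w _ => hper w).trans (le_of_eq ?_)
  rw [← sum_source_eq_sum_fiberMass source (B.store c ω) fun w x => φ s' w x + ψ w]
  simp only [hψ, mul_add, Finset.sum_add_distrib]
  rw [← Finset.sum_mul, sum_toReal_eq_one]
  ring

end

end OTProtocol

theorem prob_bind_le_add {Ω Ω' : Type} (P : PMF Ω) (f g : Ω → PMF Ω') (E : Set Ω') {d : ℝ}
    (hd : 0 ≤ d) (h : ∀ a, prob (f a) E ≤ prob (g a) E + d) :
    prob (P.bind f) E ≤ prob (P.bind g) E + d := by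
  have := prob_bind_le_of_events P f g E d hd (fun i : Empty => i.elim) (fun i => i.elim)
    (fun i => i.elim) (by simpa using h)
  simpa using this

theorem prob_uniformSubset_bind {Ω : Type} {n k : ℕ} (h : k ≤ n) (f : Subset n k → PMF Ω)
    (E : Set Ω) :
    prob ((uniformSubset h).bind f) E = (∑ A, prob (f A) E) / n.choose k := by
  have := subset_nonempty h
  have := prob_uniform_bind f E
  rwa [Fintype.card_finset_len, Fintype.card_fin] at this

namespace OTProtocol

variable {l : ℕ} {P : OTProtocol l} {γ : ℝ} {B : P.BobStrategy γ} {c : Bool}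
  {source : PMF (Bits P.n × Bits P.n)} {K η ε' β : ℝ}

open Classical in
-- At most 2^(γn+1) strings can be stored, and each of those counted has mass below ε'/2^(γn+1).
theorem sum_light_memory_le (hε' : 0 ≤ ε') (ω : B.Coins) :
    ∑ x, (source x).toReal *
      (if memoryMass B c source ω (B.store c ω x.2) * 2 ^ (γ * P.n + 1) < ε' then (1 : ℝ) else 0) ≤
      ε' := by
  rw [sum_source_eq_sum_fiberMass source (B.store c ω) fun w _ =>
    if memoryMass B c source ω w * 2 ^ (γ * P.n + 1) < ε' then (1 : ℝ) else 0]
  have ha : 0 ≤ γ * P.n := by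
    have := (B.store c ω fun _ => false).2
    exact (Nat.cast_nonneg _).trans this
  have h2 : (0 : ℝ) < 2 ^ (γ * P.n + 1) := by positivity
  have hw : ∀ w ∈ Finset.univ.image (B.store c ω), ∑ x, fiberMass source (B.store c ω) w x *
      (if memoryMass B c source ω w * 2 ^ (γ * P.n + 1) < ε' then (1 : ℝ) else 0) ≤
        ε' / 2 ^ (γ * P.n + 1) := by
    intro w _
    rw [← Finset.sum_mul]
    change memoryMass B c source ω w * _ ≤ _
    split_ifs with h
    · rw [mul_one, le_div_iff₀ h2]; exact h.le
    · rw [mul_zero]; positivity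
  refine (Finset.sum_le_sum hw).trans ?_
  rw [Finset.sum_const, nsmul_eq_mul, ← mul_div_assoc, div_le_iff₀ h2, mul_comm]
  exact mul_le_mul_of_nonneg_left (card_memories_le _ ha) hε'

open Classical in
-- A light w is charged with all A, any other w only with the A that have many bad subsets.
theorem sum_exceptional_le {d : ℝ} (hd : 0 ≤ d) (hε' : 0 ≤ ε') (ω : B.Coins)
    (hmany : ∀ w, ε' ≤ memoryMass B c source ω w * 2 ^ (γ * P.n + 1) →
      (((Finset.univ : Finset (Subset P.n P.k)).filter fun A =>
        β * P.k.choose l < (badSubsets B c source K η ω w A).card).card : ℝ) ≤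
        P.n.choose P.k * d) :
    ∑ A : Subset P.n P.k, ∑ x, (source x).toReal *
      (if Exceptional B c source K η ε' β ω A (B.store c ω x.2) then (1 : ℝ) else 0) ≤
      P.n.choose P.k * (ε' + d) := by
  have hw : ∀ w, ∑ A : Subset P.n P.k,
      (if Exceptional B c source K η ε' β ω A w then (1 : ℝ) else 0) ≤ P.n.choose P.k *
        ((if memoryMass B c source ω w * 2 ^ (γ * P.n + 1) < ε' then (1 : ℝ) else 0) + d) := by
    intro w
    by_cases h : memoryMass B c source ω w * 2 ^ (γ * P.n + 1) < ε'
    · rw [if_pos h]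
      have h1 : ∑ A : Subset P.n P.k,
          (if Exceptional B c source K η ε' β ω A w then (1 : ℝ) else 0) ≤
          ∑ _A : Subset P.n P.k, 1 := Finset.sum_le_sum fun A _ => by split_ifs <;> norm_num
      rw [Finset.sum_const, Finset.card_univ, Fintype.card_finset_len, Fintype.card_fin,
        nsmul_eq_mul, mul_one] at h1
      have h2 : (0 : ℝ) ≤ P.n.choose P.k * d := mul_nonneg (Nat.cast_nonneg _) hd
      linarith
    · rw [if_neg h, zero_add]
      refine le_trans (le_of_eq ?_) (hmany w (not_lt.1 h))
      rw [Finset.card_filter, Nat.cast_sum]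
      refine Finset.sum_congr rfl fun A _ => ?_
      simp only [Exceptional, h, false_or, Nat.cast_ite, Nat.cast_one, Nat.cast_zero]
  rw [Finset.sum_comm]
  simp only [← Finset.mul_sum]
  refine (Finset.sum_le_sum fun x _ => mul_le_mul_of_nonneg_left (hw _)
    (ENNReal.toReal_nonneg (a := source x))).trans ?_
  simp only [mul_left_comm _ (P.n.choose P.k : ℝ)]
  rw [← Finset.mul_sum]
  refine mul_le_mul_of_nonneg_left ?_ (Nat.cast_nonneg _)
  simp only [mul_add, Finset.sum_add_distrib]
  rw [← Finset.sum_mul, sum_toReal_eq_one, one_mul]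
  linarith [sum_light_memory_le (B := B) (c := c) (source := source) hε' ω]

/-- The losses are: η for strings not spread on a good subset, L for rare leak values, 2|ε| for the
extractor, |θ| for two bad outputs of hashing, ε' for light stored strings and d for positions with
many bad subsets. -/
theorem prob_view_le {κ ε L d t θ : ℝ}
    (hsec : ∀ X : PMF (Bits l), κ ≤ minEntropy X →
      statDist (extractLaw P.extract X) (idealLaw P.extract X) ≤ ε)
    (hbind : ∀ T : Finset (Bits P.m), (T.card : ℝ) ≤ (2 : ℝ) ^ t → ∀ B : PMF P.hashing.PlayB,
      prob (P.hashing.lawB B) {V | V false ∈ T ∧ V true ∈ T} ≤ θ)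
    (hlk : l ≤ P.k) (ht : β * 2 ^ P.m ≤ (2 : ℝ) ^ t)
    (hε' : 0 < ε') (hK : 0 ≤ K) (hη : 0 ≤ η) (hd : 0 ≤ d)
    (hL : 2 ^ (P.q + P.p) * (K * (2 : ℝ) ^ κ) ≤ L)
    (hmany : ∀ ω w, ε' ≤ memoryMass B c source ω w * 2 ^ (γ * P.n + 1) →
      (((Finset.univ : Finset (Subset P.n P.k)).filter fun A =>
        β * P.k.choose l < (badSubsets B c source K η ω w A).card).card : ℝ) ≤
        P.n.choose P.k * d)
    (s s' : SetupView B → Bool → Bits P.q)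
    (hs : ∀ v, s v (knownIndex B c source K η v) = s' v (knownIndex B c source K η v))
    (E : Set (SetupView B × P.TransferMessage)) :
    prob (view B c source s) E ≤ prob (view B c source s') E +
      (η + L + 2 * |ε| + |θ| + (ε' + d)) := by
  classical
  have hL0 : 0 ≤ L := le_trans (by positivity) hL
  have hC0 : 0 ≤ η + L + 2 * |ε| := add_nonneg (add_nonneg hη hL0) (by positivity)
  rw [view_eq, view_eq]
  refine prob_bind_le_add _ _ _ E (by positivity) fun ω => ?_
  have hA : ∀ A, prob (P.hashing.coinsA.bind fun a => viewOfCoins B c source s ω A a) E ≤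
      prob (P.hashing.coinsA.bind fun a => viewOfCoins B c source s' ω A a) E +
        (η + L + 2 * |ε| + |θ| + ∑ x, (source x).toReal *
          (if Exceptional B c source K η ε' β ω A (B.store c ω x.2) then (1 : ℝ) else 0)) := by
    intro A
    have hexc : 0 ≤ ∑ x, (source x).toReal *
        (if Exceptional B c source K η ε' β ω A (B.store c ω x.2) then (1 : ℝ) else 0) :=
      Finset.sum_nonneg fun x _ => mul_nonneg ENNReal.toReal_nonneg
        (by split_ifs <;> norm_num)
    refine (prob_bind_le_of_events P.hashing.coinsA _ _ E _ (add_nonneg hC0 hexc)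
      (fun x => (source x).toReal) (fun _ => ENNReal.toReal_nonneg)
      (fun x => bothBad B c source K η ε' β ω A (B.store c ω x.2))
      fun a => prob_viewOfCoins_le hsec hε' hK hη hL s s' hs E ω A a).trans ?_
    have h1 : ∑ x, (source x).toReal *
        prob P.hashing.coinsA (bothBad B c source K η ε' β ω A (B.store c ω x.2)) ≤ |θ| := by
      refine (Finset.sum_le_sum fun x _ => mul_le_mul_of_nonneg_left
        (prob_bothBad_le hbind hlk ht ω A _) (ENNReal.toReal_nonneg (a := source x))).trans ?_
      rw [← Finset.sum_mul, sum_toReal_eq_one, one_mul]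
    linarith
  rw [prob_uniformSubset_bind, prob_uniformSubset_bind]
  have hnk : (0 : ℝ) < P.n.choose P.k := by exact_mod_cast Nat.choose_pos P.k_le
  rw [div_le_iff₀ hnk, add_mul, div_mul_cancel₀ _ hnk.ne']
  refine (Finset.sum_le_sum fun A _ => hA A).trans ?_
  have h2 := sum_exceptional_le (β := β) (K := K) (η := η) hd hε'.le ω (hmany ω)
  rw [Finset.sum_add_distrib, Finset.sum_add_distrib, Finset.sum_const, Finset.card_univ,
    Fintype.card_finset_len, Fintype.card_fin, nsmul_eq_mul]
  linarith

end OTProtocol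

/-! ### Negligible errors and the choice of parameters. -/

theorem negligible_exp_neg {a : ℝ} (ha : 0 < a) : Negligible fun l => Real.exp (-(a * l)) := by
  intro N
  have h1 : Filter.Tendsto (fun l : ℕ => a * (l : ℝ)) Filter.atTop Filter.atTop :=
    Filter.Tendsto.const_mul_atTop ha tendsto_natCast_atTop_atTop
  have h2 := ((Real.tendsto_pow_mul_exp_neg_atTop_nhds_zero N).comp h1).const_mul ((a ^ N)⁻¹)
  rw [mul_zero] at h2
  refine h2.congr fun l => ?_
  simp only [Function.comp]
  rw [mul_pow, ← mul_assoc, ← mul_assoc, inv_mul_cancel₀ (pow_ne_zero _ ha.ne'), one_mul]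

theorem Negligible.abs {f : ℕ → ℝ} (hf : Negligible f) : Negligible fun l => |f l| := by
  intro N
  have := (hf N).abs
  rw [abs_zero] at this
  refine this.congr fun l => ?_
  rw [abs_mul, abs_of_nonneg (by positivity)]

/-- The bound on the distance of Bob's views. -/
def securityError (τ ζ : ℝ) (ε' εhat εF θ : ℕ → ℝ) (l : ℕ) : ℝ :=
  3 * Real.exp (-((nu τ ^ 2 * (1 - ζ) / 4) * l)) + εhat l + 2 * |εF l| + |θ l| + ε' l

theorem negligible_securityError {τ ζ : ℝ} (h0 : 0 < τ) (h1 : τ < 1 / 3) (hζ : ζ < 1)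
    {ε' εhat εF θ : ℕ → ℝ} (nε' : Negligible ε') (nεhat : Negligible εhat)
    (nεF : Negligible εF) (nθ : Negligible θ) :
    Negligible (securityError τ ζ ε' εhat εF θ) := by
  have hL := one_le_logb_inv h0 h1
  have hnu : 0 < nu τ := div_pos h0 (by linarith)
  have ha : 0 < nu τ ^ 2 * (1 - ζ) / 4 := by
    have : 0 < 1 - ζ := by linarith
    positivity
  exact ((((negligible_exp_neg ha).const_mul 3).add nεhat).add (nεF.abs.const_mul 2)).add nθ.abs
    |>.add nε'

namespace OTProtocol

variable {l : ℕ} {P : OTProtocol l} {α γ δ ξ τ ζ c R mF t ε' εhat εF θ : ℝ}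

/-- The conditions k ≥ 2√(ln) and k ≤ n give 4ln ≤ n². -/
theorem Admissible.four_mul_le (h : P.Admissible α γ δ ξ τ ζ c R mF t ε' εhat εF θ) :
    4 * l ≤ P.n := by
  have h1 : 2 * Real.sqrt (l * P.n) ≤ P.n := by
    refine (Nat.le_ceil _).trans ?_
    rw [← h.k_eq]
    exact_mod_cast P.k_le
  have hn : (0 : ℝ) < P.n := by exact_mod_cast h.n_pos
  have hs := Real.sq_sqrt (show (0 : ℝ) ≤ l * P.n by positivity)
  have h2 := pow_le_pow_left₀ (by positivity) h1 2
  rw [mul_pow, hs] at h2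
  have h3 : (4 * l : ℝ) ≤ P.n := by
    refine le_of_mul_le_mul_right ?_ hn
    nlinarith
  exact_mod_cast h3

theorem Admissible.le_k (h : P.Admissible α γ δ ξ τ ζ c R mF t ε' εhat εF θ) : l ≤ P.k := by
  have h4 : (4 : ℝ) * l ≤ P.n := by exact_mod_cast h.four_mul_le
  have hl : (0 : ℝ) ≤ l := Nat.cast_nonneg l
  have h1 : (l : ℝ) ≤ Real.sqrt (l * P.n) := Real.le_sqrt_of_sq_le (by nlinarith)
  have h2 : (l : ℝ) ≤ P.k := by
    rw [h.k_eq]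
    refine le_trans ?_ (Nat.le_ceil _)
    linarith
  exact_mod_cast h2

/-- With e = ε' + ε'' the lower bound on t reads 2^t ≥ e^ζ·2^m, and e exceeds its summand
exp(-lν²/2). -/
theorem Admissible.binding_threshold (h : P.Admissible α γ δ ξ τ ζ c R mF t ε' εhat εF θ)
    (hε' : 0 < ε') (hζ : 0 < ζ) :
    Real.exp (-(l * nu τ ^ 2 / 2)) ^ ζ * 2 ^ P.m ≤ (2 : ℝ) ^ t := by
  set e := ε' + epsSample τ c l P.n with he
  have hD : Real.exp (-(l * nu τ ^ 2 / 2)) ≤ e := by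
    have : (0 : ℝ) < 2 ^ (-(c * τ * P.n)) := by positivity
    rw [he, epsSample]; linarith
  have he0 : 0 < e := (Real.exp_pos _).trans_le hD
  have h1 := Real.rpow_le_rpow_of_exponent_le one_le_two h.t_ge
  refine le_trans ?_ h1
  have h2 : (P.m : ℝ) - ζ * Real.logb 2 (1 / e) = Real.logb 2 e * ζ + P.m := by
    rw [one_div, Real.logb_inv]; ring
  rw [h2, Real.rpow_add two_pos, Real.rpow_mul two_pos.le,
    Real.rpow_logb two_pos (by norm_num) he0, Real.rpow_natCast]
  exact mul_le_mul_of_nonneg_right (Real.rpow_le_rpow (Real.exp_pos _).le hD hζ.le) (by positivity)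

/-- `kF` is defined so that the exponents cancel down to log ε̂ - (m_F l + 1). -/
theorem Admissible.leak_le (h : P.Admissible α γ δ ξ τ ζ c R mF t ε' εhat εF θ)
    (hl : 0 < l) (hεhat : 0 < εhat) :
    2 ^ (P.q + P.p) * ((2 : ℝ) ^ (-((rho α γ ε' P.n - 3 * τ) * l)) *
      (2 : ℝ) ^ (kF (rho α γ ε' P.n) R τ mF εhat l * l)) ≤ εhat := by
  have hl' : (l : ℝ) ≠ 0 := Nat.cast_ne_zero.2 hl.ne'
  rw [← Real.rpow_natCast, ← Real.rpow_add two_pos, ← Real.rpow_add two_pos]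
  have e : ((P.q + P.p : ℕ) : ℝ) + (-((rho α γ ε' P.n - 3 * τ) * l) +
      kF (rho α γ ε' P.n) R τ mF εhat l * l) = Real.logb 2 εhat - (mF * l + 1) := by
    rw [Nat.cast_add, h.q_eq, h.p_eq, kF, one_div, Real.logb_inv]
    field_simp
    ring
  rw [e]
  have hmF := h.mF_pos
  refine (Real.rpow_le_rpow_of_exponent_le one_le_two (sub_le_self _ (by positivity))).trans ?_
  rw [Real.rpow_logb two_pos (by norm_num) hεhat]

/-- What Bob stores has nonnegative length, so for negative γ there is no strategy at all. -/
theorem BobStrategy.storage_nonneg (B : P.BobStrategy γ) : 0 ≤ γ * P.n := by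
  obtain ⟨ω, -⟩ := B.coins.support_nonempty
  exact (Nat.cast_nonneg _).trans (B.store false ω fun _ => false).2

theorem Admissible.tau_lt (h : P.Admissible α γ δ ξ τ ζ c R mF t ε' εhat εF θ)
    (hε' : 0 < ε') (hε'1 : ε' ≤ 1) (B : P.BobStrategy γ) : τ < 1 / 3 := by
  have hn : (0 : ℝ) < P.n := by exact_mod_cast h.n_pos
  have hγ : 0 ≤ γ := nonneg_of_mul_nonneg_left B.storage_nonneg hn
  have h1 := h.τ_le
  have h2 := h.α_lt_one
  have h3 : 0 ≤ Real.logb 2 (1 / ε') := Real.logb_nonneg one_lt_two ((one_le_div hε').2 hε'1)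
  have h4 : 0 ≤ (1 + Real.logb 2 (1 / ε')) / P.n := by positivity
  rw [rho] at h1
  linarith

theorem secureForAlice_of_one_le {lam : ℝ} (h : 1 ≤ lam) : P.SecureForAlice α γ δ lam :=
  fun _ _ _ _ _ => ⟨fun _ => false, fun _ _ _ =>
    (ciSup_le fun E => abs_prob_sub_le_one _ _ E).trans h⟩

theorem Admissible.secureForAlice (h : P.Admissible α γ δ ξ τ ζ c R mF t ε' εhat εF θ)
    (hl : 0 < l) (hτ : 0 < τ) (hτ' : τ < 1 / 3) (hζ : 0 < ζ) (hε' : 0 < ε') (hεhat : 0 < εhat) :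
    P.SecureForAlice α γ δ
      (3 * Real.exp (-((nu τ ^ 2 * (1 - ζ) / 4) * l)) + εhat + 2 * |εF| + |θ| + ε') := by
  intro source hmin _ B ch
  set D := Real.exp (-(l * nu τ ^ 2 / 2)) with hD
  set η := Real.exp (-((nu τ ^ 2 * (1 - ζ) / 4) * l)) with hη
  set K := (2 : ℝ) ^ (-((rho α γ ε' P.n - 3 * τ) * l)) with hK
  have hη0 : 0 < η := Real.exp_pos _
  have hβ0 : 0 < D ^ ζ := Real.rpow_pos_of_pos (Real.exp_pos _) _
  -- η is chosen with η² = D^(1-ζ). The loss 2D/(D^ζ η) from the two Markov bounds then equals 2η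
  -- and, with the tolerated mass η, makes up the term 3η.
  have hd : 2 * D / (D ^ ζ * η) = 2 * η := by
    rw [div_eq_iff (by positivity)]
    have : D = η * D ^ ζ * η := by
      rw [hD, hη, ← Real.exp_mul, ← Real.exp_add, ← Real.exp_add]
      congr 1; ring
    linarith
  have hmany : ∀ ω w, ε' ≤ memoryMass B ch source ω w * 2 ^ (γ * P.n + 1) →
      (((Finset.univ : Finset (Subset P.n P.k)).filter fun A =>
        D ^ ζ * P.k.choose l < (badSubsets B ch source K η ω w A).card).card : ℝ) ≤
        P.n.choose P.k * (2 * η) := by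
    intro ω w hw
    have hm : 0 < memoryMass B ch source ω w := by
      by_contra hneg
      have := mul_nonpos_of_nonpos_of_nonneg (not_lt.1 hneg)
        (show (0 : ℝ) ≤ 2 ^ (γ * P.n + 1) by positivity)
      linarith
    rw [← hd]
    exact card_many_badSubsets_le hτ hτ' h.n_pos h.four_mul_le h.le_k hη0 hβ0 hm
      (condSource_le hε' h.n_pos hmin hw) hK
  refine ⟨knownIndex B ch source K η, fun s s' hs => ?_⟩
  have key : ∀ s s' : SetupView B → Bool → Bits P.q,
      (∀ v, s v (knownIndex B ch source K η v) = s' v (knownIndex B ch source K η v)) →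
      ∀ E, prob (view B ch source s) E ≤ prob (view B ch source s') E +
        (3 * η + εhat + 2 * |εF| + |θ| + ε') := by
    intro s s' hs E
    have := prob_view_le h.fuzzy.security h.hashing.binding h.le_k (h.binding_threshold hε' hζ) hε'
      (show 0 ≤ K by positivity) hη0.le (by positivity) (h.leak_le hl hεhat) hmany s s' hs E
    linarith
  exact statDist_le (key s s' hs) (key s' s fun v => (hs v).symm)

end OTProtocol

end

end NoisyOT

theorem mainTheorem3 (τ ζ c : ℝ) (hτ : 0 < τ) (hζ : 0 < ζ) (hζ' : ζ < 1) (hc : 0 < c)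
    (ε' εhat εF θ : ℕ → ℝ) (hε' : ∀ l, 0 < ε' l) (hεhat : ∀ l, 0 < εhat l)
    (nε' : NoisyOT.Negligible ε') (nεhat : NoisyOT.Negligible εhat)
    (nεF : NoisyOT.Negligible εF) (nθ : NoisyOT.Negligible θ) :
    ∃ lam : ℕ → ℝ, NoisyOT.Negligible lam ∧
      ∀ l : ℕ, 1 ≤ l → ∀ (α γ δ ξ R mF t : ℝ) (P : NoisyOT.OTProtocol l),
        P.Admissible α γ δ ξ τ ζ c R mF t (ε' l) (εhat l) (εF l) (θ l) →
          P.SecureForAlice α γ δ (lam l) := by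
  by_cases hτ' : τ < 1 / 3
  · exact ⟨NoisyOT.securityError τ ζ ε' εhat εF θ,
      NoisyOT.negligible_securityError hτ hτ' hζ' nε' nεhat nεF nθ,
      fun l hl α γ δ ξ R mF t P h => h.secureForAlice hl hτ hτ' hζ (hε' l) (hεhat l)⟩
  -- For τ ≥ 1/3 the function ε' itself serves. If ε' l ≤ 1, the existence of a strategy would force
  -- 3τ ≤ ρ < 1; if ε' l ≥ 1, the claim is trivial.
  · refine ⟨ε', nε', fun l _ α γ δ ξ R mF t P h => ?_⟩
    rcases le_total (ε' l) 1 with h1 | h1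
    · exact fun _ _ _ B _ => absurd (h.tau_lt (hε' l) h1 B) hτ'
    · exact NoisyOT.OTProtocol.secureForAlice_of_one_le h1
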